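/- **Theorem 5.** Let $X$ be a complex manifold of dimension $3$ with a nowhere vanishing holomorphic $(3,0)$-form $\Omega$, let $\alpha'\in\mathbb R$, and for $t\in[0,\tau)$ let $\Phi(t)$ be a smooth closed $(2,2)$-form on $X$. Let $\omega=\omega(t)=i\,g_{\bar kj}\,dz^j\wedge d\bar z^k$, $t\in[0,\tau)$, be a family of Hermitian metrics, smooth on $[0,\tau)\times X$, which solves the Anomaly flow $$\partial_t(\|\Omega\|_\omega\,\omega^2)=\Psi,\qquad \Psi:=i\partial\bar\partial\omega-\alpha'\big({\rm Tr}(Rm\wedge Rm)-\Phi(t)\big),\qquad \|\Omega\|_\omega^2\,\omega^3=i\,\Omega\wedge\bar\Omega ,$$ and whose initial metric is conformally balanced, $d(\|\Omega\|_{\omega(0)}\,\omega(0)^2)=0$. Then in any holomorphic coordinates, and for all $t\in[0,\tau)$, the torsion $T=i\partial\omega=\frac12T_{\bar kjm}\,dz^m\wedge dz^j\wedge d\bar z^k$ satisfies $$\begin{aligned} \partial_tT_{\bar pjq}={}&\frac1{2\|\Omega\|_\omega}\Big[\Delta T_{\bar pjq}-\alpha' g^{s\bar r}\nabla_j\big(R_{[\bar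 ps}{}^\alpha{}_\beta R_{\bar rq]}{}^\beta{}_\alpha-\Phi_{\bar ps\bar rq}\big)+\alpha' g^{s\bar r}\nabla_q\big(R_{[\bar ps}{}^\alpha{}_\beta R_{\bar rj]}{}^\beta{}_\alpha-\Phi_{\bar ps\bar rj}\big)\Big]\\ &+\frac1{2\|\Omega\|_\omega}\Big(T^m{}_{jq}\Psi_{\bar pm}-T_j\Psi_{\bar pq}+T_q\Psi_{\bar pj}+\nabla_j(T\bar T)_{\bar pq}-\nabla_q(T\bar T)_{\bar pj}\Big)\\ &-\frac1{2\|\Omega\|_\omega}\Big(T^r{}_{q\lambda}R^\lambda{}_{r\bar pj}-T^r{}_{j\lambda}R^\lambda{}_{r\bar pq}\Big) \end{aligned}$$ (at $t=0$ the time derivative is one-sided). Here $\nabla$ is the Chern connection of $\omega$, with curvature $R_{\bar kj}{}^p{}_q=-\partial_{\bar k}(g^{p\bar m}\partial_jg_{\bar mq})$, $Rm=R_{\bar kj}{}^p{}_q\,dz^j\wedge d\bar z^k$, and $\Delta=g^{\lambda\bar\mu}\nabla_\lambda\nabla_{\bar\mu}$. Indices are raised and lowered with $g$, so that $T^m{}_{jq}=g^{m\bar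 k}T_{\bar kjq}$ and $R^\lambda{}_{r\bar pj}=g^{\lambda\bar\mu}g_{\bar p\ell}R_{\bar\mu r}{}^\ell{}_j$, and $T_m=g^{j\bar k}T_{\bar kjm}$. With $\bar T=-i\bar\partial\omega=\frac12\bar T_{k\bar j\bar m}\,d\bar z^m\wedge d\bar z^j\wedge dz^k$ we write $(T\bar T)_{\bar kj}=g^{s\bar r}g^{m\bar\ell}T_{\bar rmj}\bar T_{s\bar\ell\bar k}$. The components of a $(2,2)$-form are defined by $\Psi=\frac1{(2!)^2}\sum\Psi_{\bar ps\bar rq}\,dz^q\wedge d\bar z^r\wedge dz^s\wedge d\bar z^p$ (antisymmetric in $\bar p,\bar r$ and in $s,q$), and $\Psi_{\bar pq}=g^{s\bar r}\Psi_{\bar ps\bar rq}$. The brackets denote antisymmetrization, without normalizing factor, separately in the barred and in the unbarred indices: $$R_{[\bar ps}{}^\alpha{}_\beta R_{\bar rq]}{}^\beta{}_\alpha=R_{\bar ps}{}^\alpha{}_\beta R_{\bar rq}{}^\beta{}_\alpha-R_{\bar rs}{}^\alpha{}_\beta R_{\bar pq}{}^\beta{}_\alpha-R_{\bar pq}{}^\alpha{}_\beta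 R_{\bar rs}{}^\beta{}_\alpha+R_{\bar rq}{}^\alpha{}_\beta R_{\bar ps}{}^\beta{}_\alpha .$$ -/

import Mathlib

open scoped Manifold ContDiff ComplexConjugate

noncomputable section

namespace AnomalyFlow

/-! ## Calculus in holomorphic coordinates on an open subset of `ℂ³`

A tensor is handled through its components with respect to the complexified coordinate frame
`∂/∂z^j`, `∂/∂z̄^k`. -/

/-- The model space `ℂ³` of holomorphic coordinates. -/
abbrev C3 : Type := Fin 3 → ℂ

/-- Indices of the complexified coordinate frame: `Sum.inl j` stands for the unbarred index `j`
(the vector `∂/∂z^j`), `Sum.inr k` for the barred index `k̄` (the vector `∂/∂z̄^k`). -/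
abbrev Idx : Type := Fin 3 ⊕ Fin 3

/-- Components of a covariant tensor field of rank `k`. A complex differential form `φ` of degree
`k` is the case where they are alternating: `φ a = φ(∂_{a 0}, …, ∂_{a (k-1)})`, that is
`φ = (1 / k!) ∑ φ a • dz^{a 0} ∧ ⋯ ∧ dz^{a (k-1)}` (with `dz̄` for the barred indices). -/
abbrev Coeffs (k : ℕ) : Type := (Fin k → Idx) → C3 → ℂ

/-- The Wirtinger derivative `∂_j = (∂_{x^j} - i ∂_{y^j}) / 2`, or
`∂_{k̄} = (∂_{x^k} + i ∂_{y^k}) / 2`. -/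
def wirt : Idx → (C3 → ℂ) → C3 → ℂ
  | Sum.inl j, f, z =>
      (fderiv ℝ f z (Pi.single j 1) - Complex.I * fderiv ℝ f z (Pi.single j Complex.I)) / 2
  | Sum.inr k, f, z =>
      (fderiv ℝ f z (Pi.single k 1) + Complex.I * fderiv ℝ f z (Pi.single k Complex.I)) / 2

/-- The wedge product of differential forms, as the signed sum over `(k, l)`-shuffles. -/
def wedge {k l : ℕ} (φ : Coeffs k) (ψ : Coeffs l) : Coeffs (k + l) := fun a z =>
  ∑ σ : Equiv.Perm (Fin (k + l)) with
      (∀ i j : Fin k, i < j → σ (Fin.castAdd l i) < σ (Fin.castAdd l j)) ∧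
      (∀ i j : Fin l, i < j → σ (Fin.natAdd k i) < σ (Fin.natAdd k j)),
    ((Equiv.Perm.sign σ : ℤ) : ℂ) * φ (fun i => a (σ (Fin.castAdd l i))) z
      * ψ (fun i => a (σ (Fin.natAdd k i))) z

/-- The operator `∂ = ∑ dz^j ∧ ∂_j` on differential forms. -/
def del {k : ℕ} (φ : Coeffs k) : Coeffs (k + 1) := fun a z =>
  ∑ i : Fin (k + 1), if (a i).isLeft then
    (-1) ^ (i : ℕ) * wirt (a i) (φ (fun m => a (i.succAbove m))) z else 0

/-- The operator `∂̄ = ∑ dz̄^k ∧ ∂_{k̄}` on differential forms. -/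
def delbar {k : ℕ} (φ : Coeffs k) : Coeffs (k + 1) := fun a z =>
  ∑ i : Fin (k + 1), if (a i).isRight then
    (-1) ^ (i : ℕ) * wirt (a i) (φ (fun m => a (i.succAbove m))) z else 0

/-- The exterior derivative `d = ∂ + ∂̄`. -/
def extD {k : ℕ} (φ : Coeffs k) : Coeffs (k + 1) := fun a z => del φ a z + delbar φ a z

/-- The complex conjugate of a tensor. -/
def conjC {k : ℕ} (φ : Coeffs k) : Coeffs k := fun a z => conj (φ (fun i => (a i).swap) z)

/-! ### Hermitian metrics in coordinates: `G z k j = g_{k̄j}` and `(G z)⁻¹ s r = g^{s r̄}` -/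

/-- Matrix functions, such as the components `G z k j = g_{k̄j}` of a Hermitian metric. -/
abbrev MatFun : Type := C3 → Matrix (Fin 3) (Fin 3) ℂ

/-- The Hermitian form `ω = i g_{k̄j} dz^j ∧ dz̄^k`. -/
def kahler (G : MatFun) : Coeffs 2 := fun a z =>
  match a 0, a 1 with
  | Sum.inl j, Sum.inr k => Complex.I * G z k j
  | Sum.inr k, Sum.inl j => -(Complex.I * G z k j)
  | _, _ => 0

/-- The connection coefficients `A_{jq}^m = g^{m k̄} ∂_j g_{k̄q}` of the Chern connection. -/
def chernA (G : MatFun) (j q m : Fin 3) : C3 → ℂ := fun z =>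
  ∑ k, (G z)⁻¹ m k * wirt (Sum.inl j) (fun w => G w k q) z

/-- The coefficients `Γ_{ab}^c` of the Chern connection on the complexified tangent bundle,
`∇_{∂_a} ∂_b = ∑ Γ_{ab}^c ∂_c`. -/
def christoffel (G : MatFun) : Idx → Idx → Idx → C3 → ℂ
  | Sum.inl j, Sum.inl q, Sum.inl m, z => chernA G j q m z
  | Sum.inr j, Sum.inr q, Sum.inr m, z => conj (chernA G j q m z)
  | _, _, _, _ => 0

/-- The covariant derivative of a covariant tensor; the index of differentiation comes first. -/
def nabla (G : MatFun) {k : ℕ} (φ : Coeffs k) : Coeffs (k + 1) := fun a z =>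
  wirt (a 0) (φ (Fin.tail a)) z
    - ∑ i : Fin k, ∑ c : Idx,
        christoffel G (a 0) (a i.succ) c z * φ (Function.update (Fin.tail a) i c) z

/-- The curvature `R_{k̄j}{}^p{}_q = -∂_{k̄} (g^{p m̄} ∂_j g_{m̄q})` of the Chern connection. -/
def curv (G : MatFun) (k j p q : Fin 3) : C3 → ℂ := fun z =>
  -wirt (Sum.inr k) (chernA G j q p) z

/-- The curvature with lowered index, `R_{k̄jℓ̄m} = g_{ℓ̄p} R_{k̄j}{}^p{}_m`. -/
def curvLow (G : MatFun) (k j l m : Fin 3) : C3 → ℂ := fun z =>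
  ∑ p, G z l p * curv G k j p m z

/-- The entries `Rm^p{}_q = R_{k̄j}{}^p{}_q dz^j ∧ dz̄^k` of the curvature form. -/
def curvForm (G : MatFun) (p q : Fin 3) : Coeffs 2 := fun a z =>
  match a 0, a 1 with
  | Sum.inl j, Sum.inr k => curv G k j p q z
  | Sum.inr k, Sum.inl j => -curv G k j p q z
  | _, _ => 0

/-- The 4-form `Tr (Rm ∧ Rm)`. -/
def trRmRm (G : MatFun) : Coeffs 4 := fun a z =>
  ∑ α, ∑ β, wedge (curvForm G α β) (curvForm G β α) a z

/-- The norm `‖Ω‖_ω`, defined by `‖Ω‖_ω² ω³ = i Ω ∧ Ω̄`: the ratio of the two forms of top degree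
is read off on the frame `∂_1, ∂_2, ∂_3, ∂_1̄, ∂_2̄, ∂_3̄`. -/
def normOm (Om : Coeffs 3) (G : MatFun) : C3 → ℝ := fun z =>
  let top : Fin 6 → Idx :=
    ![Sum.inl 0, Sum.inl 1, Sum.inl 2, Sum.inr 0, Sum.inr 1, Sum.inr 2]
  Real.sqrt (Complex.I * wedge Om (conjC Om) top z
    / wedge (wedge (kahler G) (kahler G)) (kahler G) top z).re

/-- The 4-form `‖Ω‖_ω ω²`. -/
def balancedForm (Om : Coeffs 3) (G : MatFun) : Coeffs 4 := fun a z =>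
  (normOm Om G z : ℂ) * wedge (kahler G) (kahler G) a z

/-- The form `Ψ = i ∂∂̄ω - α' (Tr (Rm ∧ Rm) - Φ)`. -/
def Psi (α' : ℝ) (Phi : Coeffs 4) (G : MatFun) : Coeffs 4 := fun a z =>
  Complex.I * del (delbar (kahler G)) a z - (α' : ℂ) * (trRmRm G a z - Phi a z)

/-- The components `φ_{p̄ s r̄ q}` of a (2,2)-form,
`φ = (1 / 2!²) ∑ φ_{p̄ s r̄ q} dz^q ∧ dz̄^r ∧ dz^s ∧ dz̄^p`. -/
def comp22 (φ : Coeffs 4) (p s r q : Fin 3) : C3 → ℂ :=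
  φ ![Sum.inl q, Sum.inr r, Sum.inl s, Sum.inr p]

/-- `Ψ_{p̄q} = g^{s r̄} Ψ_{p̄ s r̄ q}`. -/
def Psi2 (α' : ℝ) (Phi : Coeffs 4) (G : MatFun) (p q : Fin 3) : C3 → ℂ := fun z =>
  ∑ s, ∑ r, (G z)⁻¹ s r * comp22 (Psi α' Phi G) p s r q z

/-- The torsion form `T = i ∂ω`. -/
def torsion (G : MatFun) : Coeffs 3 := fun a z => Complex.I * del (kahler G) a z

/-- The form `T̄ = -i ∂̄ω`. -/
def torsionBar (G : MatFun) : Coeffs 3 := fun a z => -(Complex.I * delbar (kahler G) a z)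

/-- The components `T_{k̄jm}` of the torsion, `T = (1/2) T_{k̄jm} dz^m ∧ dz^j ∧ dz̄^k`. -/
def tor (G : MatFun) (k j m : Fin 3) : C3 → ℂ :=
  torsion G ![Sum.inl m, Sum.inl j, Sum.inr k]

/-- The components `T̄_{k j̄ m̄}`, `T̄ = (1/2) T̄_{k j̄ m̄} dz̄^m ∧ dz̄^j ∧ dz^k`. -/
def torBar (G : MatFun) (k j m : Fin 3) : C3 → ℂ :=
  torsionBar G ![Sum.inr m, Sum.inr j, Sum.inl k]

/-- `T^m{}_{jq} = g^{m k̄} T_{k̄jq}`. -/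
def torUp (G : MatFun) (m j q : Fin 3) : C3 → ℂ := fun z =>
  ∑ k, (G z)⁻¹ m k * tor G k j q z

/-- `T_m = g^{j k̄} T_{k̄jm}`. -/
def torTr (G : MatFun) (m : Fin 3) : C3 → ℂ := fun z =>
  ∑ j, ∑ k, (G z)⁻¹ j k * tor G k j m z

/-- `(T T̄)_{k̄j} = g^{s r̄} g^{m ℓ̄} T_{r̄mj} T̄_{s ℓ̄ k̄}`. -/
def TT (G : MatFun) (k j : Fin 3) : C3 → ℂ := fun z =>
  ∑ s, ∑ r, ∑ m, ∑ l, (G z)⁻¹ s r * (G z)⁻¹ m l * tor G r m j z * torBar G s l k z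

/-- `R^λ{}_{r p̄ j} = g^{λ μ̄} R_{μ̄ r p̄ j}`. -/
def curvUp (G : MatFun) (lam r p j : Fin 3) : C3 → ℂ := fun z =>
  ∑ μ, (G z)⁻¹ lam μ * curvLow G μ r p j z

/-- `R_{[p̄s}{}^α{}_β R_{r̄q]}{}^β{}_α`: the antisymmetrization, without normalizing factor,
separately in the barred indices `p̄, r̄` and in the unbarred indices `s, q`. -/
def RR (G : MatFun) (p s r q : Fin 3) : C3 → ℂ := fun z =>
  ∑ α, ∑ β,
    (curv G p s α β z * curv G r q β α z - curv G r s α β z * curv G p q β α z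
      - curv G p q α β z * curv G r s β α z + curv G r q α β z * curv G p s β α z)

/-- The tensor with components `F p q` of type `p̄ q` (the other components vanish). -/
def tensor2 (F : Fin 3 → Fin 3 → C3 → ℂ) : Coeffs 2 := fun a z =>
  match a 0, a 1 with
  | Sum.inr p, Sum.inl q => F p q z
  | _, _ => 0

/-- The tensor with components `F p s r q` of type `p̄ s r̄ q` (the other components vanish). -/
def tensor4 (F : Fin 3 → Fin 3 → Fin 3 → Fin 3 → C3 → ℂ) : Coeffs 4 := fun a z =>
  match a 0, a 1, a 2, a 3 with
  | Sum.inr p, Sum.inl s, Sum.inr r, Sum.inl q => F p s r q z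
  | _, _, _, _ => 0

/-- `(Δ T)_{p̄jq} = g^{λ μ̄} ∇_λ ∇_μ̄ T_{p̄jq}`. -/
def lapTor (G : MatFun) (p j q : Fin 3) : C3 → ℂ := fun z =>
  ∑ lam, ∑ μ, (G z)⁻¹ lam μ *
    nabla G (nabla G (torsion G))
      ![Sum.inl lam, Sum.inr μ, Sum.inl q, Sum.inl j, Sum.inr p] z

/-- `∇_j (T T̄)_{p̄q}`. -/
def nablaTT (G : MatFun) (j p q : Fin 3) : C3 → ℂ :=
  nabla G (tensor2 (TT G)) ![Sum.inl j, Sum.inr p, Sum.inl q]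

/-- `g^{s r̄} ∇_j (R_{[p̄s}{}^α{}_β R_{r̄q]}{}^β{}_α - Φ_{p̄ s r̄ q})`. -/
def nablaRRPhi (Phi : Coeffs 4) (G : MatFun) (j p q : Fin 3) : C3 → ℂ := fun z =>
  ∑ s, ∑ r, (G z)⁻¹ s r *
    nabla G (tensor4 fun p s r q w => RR G p s r q w - comp22 Phi p s r q w)
      ![Sum.inl j, Sum.inr p, Sum.inl s, Sum.inr r, Sum.inl q] z

/-! ## Objects on a complex threefold -/

section Manifold

variable {X : Type*} [TopologicalSpace X] [ChartedSpace C3 X]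

/-- The holomorphic coordinate systems of `X`. -/
def holCharts (X : Type*) [TopologicalSpace X] [ChartedSpace C3 X] :
    Set (OpenPartialHomeomorph X C3) :=
  IsManifold.maximalAtlas 𝓘(ℂ, C3) ω X

/-- The holomorphic tangent vector `∂/∂z^j` of the coordinates `e` at the point with
coordinates `z`. -/
def coordVec (e : OpenPartialHomeomorph X C3) (z : C3) (j : Fin 3) :
    TangentSpace 𝓘(ℂ, C3) (e.symm z) :=
  mfderiv 𝓘(ℂ, C3) 𝓘(ℂ, C3) e.symm z (Pi.single j 1 : C3)

/-- Hermitian metrics on `X`, conjugate linear in the first argument. Smoothness is not part of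
the structure. -/
structure HermMetric (X : Type*) [TopologicalSpace X] [ChartedSpace C3 X] where
  toFun : ∀ x : X, TangentSpace 𝓘(ℂ, C3) x →ₗ⋆[ℂ] TangentSpace 𝓘(ℂ, C3) x →ₗ[ℂ] ℂ
  conj_symm : ∀ (x : X) (u v : TangentSpace 𝓘(ℂ, C3) x), conj (toFun x u v) = toFun x v u
  pos : ∀ (x : X) (v : TangentSpace 𝓘(ℂ, C3) x), v ≠ 0 → 0 < (toFun x v v).re

/-- The components `g_{k̄j}` of a Hermitian metric in coordinates. -/
def HermMetric.mat (g : HermMetric X) (e : OpenPartialHomeomorph X C3) : MatFun := fun z =>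
  Matrix.of fun k j => g.toFun (e.symm z) (coordVec e z k) (coordVec e z j)

/-- (3,0)-forms on `X`. -/
abbrev Form30 (X : Type*) [TopologicalSpace X] [ChartedSpace C3 X] : Type _ :=
  ∀ x : X, TangentSpace 𝓘(ℂ, C3) x [⋀^Fin 3]→ₗ[ℂ] ℂ

/-- The components of a (3,0)-form in coordinates. -/
def coeffs30 (Om : Form30 X) (e : OpenPartialHomeomorph X C3) : Coeffs 3 := fun a z =>
  if ∀ i, (a i).isLeft then
    Om (e.symm z) (fun i => coordVec e z ((a i).elim id id)) else 0

/-- `Ω` is a nowhere vanishing holomorphic (3,0)-form. -/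
structure IsHolVolume (Om : Form30 X) : Prop where
  holomorphic : ∀ e ∈ holCharts X,
    AnalyticOnNhd ℂ (fun z => Om (e.symm z) (coordVec e z)) e.target
  ne_zero : ∀ x, Om x ≠ 0

/-- Complex valued differential forms of degree `k` on `X` (real multilinear and alternating). -/
abbrev CForm (X : Type*) [TopologicalSpace X] [ChartedSpace C3 X] (k : ℕ) : Type _ :=
  ∀ x : X, TangentSpace 𝓘(ℂ, C3) x [⋀^Fin k]→ₗ[ℝ] ℂ

/-- The components of a complex differential form in the frame `∂/∂z^j`, `∂/∂z̄^k`: the form is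
extended complex multilinearly to the vectors `(v - i J v) / 2` and `(v + i J v) / 2`, where `J`
is the complex structure. -/
def coeffs {k : ℕ} (φ : CForm X k) (e : OpenPartialHomeomorph X C3) : Coeffs k := fun a z =>
  ∑ S : Finset (Fin k),
    (∏ i, if i ∈ S then (if (a i).isLeft then -Complex.I else Complex.I) / 2 else 1 / 2) *
      φ (e.symm z) (fun i =>
        if i ∈ S then Complex.I • coordVec e z ((a i).elim id id)
        else coordVec e z ((a i).elim id id))

/-- `φ` is a smooth closed (2,2)-form. -/
structure IsClosed22 (φ : CForm X 4) : Prop where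
  smooth : ∀ e ∈ holCharts X, ∀ a, ContDiffOn ℝ ∞ (coeffs φ e a) e.target
  type22 : ∀ e ∈ holCharts X, ∀ z ∈ e.target, ∀ a : Fin 4 → Idx,
    (Finset.univ.filter fun i => (a i).isLeft).card ≠ 2 → coeffs φ e a z = 0
  closed : ∀ e ∈ holCharts X, ∀ z ∈ e.target, ∀ a, extD (coeffs φ e) a z = 0

/-- The Hermitian metric is conformally balanced, `d (‖Ω‖_ω ω²) = 0`. -/
def IsConformallyBalanced (Om : Form30 X) (g : HermMetric X) : Prop :=
  ∀ e ∈ holCharts X, ∀ z ∈ e.target, ∀ a,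
    extD (balancedForm (coeffs30 Om e) (g.mat e)) a z = 0

/-- `g t`, `0 ≤ t < τ`, is a smooth solution of the Anomaly flow
`∂_t (‖Ω‖_ω ω²) = i ∂∂̄ω - α' (Tr (Rm ∧ Rm) - Φ(t))`. -/
structure IsAnomalyFlow (Om : Form30 X) (α' : ℝ) (Phi : ℝ → CForm X 4) (τ : ℝ)
    (g : ℝ → HermMetric X) : Prop where
  smooth : ∀ e ∈ holCharts X, ∀ k j : Fin 3,
    ContDiffOn ℝ ∞ (fun y : ℝ × C3 => (g y.1).mat e y.2 k j) (Set.Ico 0 τ ×ˢ e.target)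
  flow : ∀ e ∈ holCharts X, ∀ t ∈ Set.Ico 0 τ, ∀ z ∈ e.target, ∀ a,
    HasDerivWithinAt (fun s => balancedForm (coeffs30 Om e) ((g s).mat e) a z)
      (Psi α' (coeffs (Phi t) e) ((g t).mat e) a z) (Set.Ico 0 τ) t

end Manifold

end AnomalyFlow

end

open AnomalyFlow
open scoped Manifold ContDiff

/-! Write N = ‖Ω‖_ω. The flow preserves d(Nω²) = 0: the time derivative of d(Nω²) is dΨ, and Ψ is
closed, since i∂∂̄ω is, Tr(Rm ∧ Rm) is by the second Bianchi identity, and Φ is by assumption. So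
d(Nω²) is constant in time and vanishes initially. Contracting ∂(Nω²) = 0 gives ∂_m N = N T_m
(`dl_eq_of_balanced`), that is, T_m = ∂_m log N. Since 6 N² det g = |f|², with f the holomorphic
coefficient of Ω, this yields 2 ∂_p̄ T_q = R_{p̄q}, the Ricci curvature (`dr_log_eq_ric`), together
with the conjugate identity.

Now contract the flow equation. Because N² det g does not depend on time, the left side becomes 2N
∂_t g_{p̄q}, hence 2N ∂_t g_{p̄q} = Ψ_{p̄q} (`ctr_derivation_b`). On the right, the contraction of
i∂∂̄ω contains four contractions of the curvature. The Ricci identities make three of them cancel,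
and what is left is -R̃ + TT̄ with R̃_{p̄q} = g^{λμ̄} R_{μ̄λp̄q} (`ctr_K`).

Finally ∂_t T_{p̄jq} is the antisymmetrization in j, q of ∂_j(Ψ_{p̄q} / 2N). Differentiating N
produces the terms T_j Ψ_{p̄q}, and replacing ∂ by ∇ produces T^m_{jq} Ψ_{p̄m}. In the
antisymmetrized ∇_j R̃_{p̄q} the second Bianchi identity moves the derivative onto the contracted
index λ, at the cost of torsion times curvature. By the first Bianchi identity the antisymmetrized
curvature is ∇_μ̄ T, so ΔT appears (`nabla2_Rt_antisymm`).

The tensor calculus takes place over an arbitrary commutative ℂ-algebra with commuting derivations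
and an invertible matrix (`HermData`); conjugation is replaced by `swap`, which exchanges ∂ with ∂̄
and transposes g. The algebra finally used consists of the functions smooth within [0,τ) × U, and
`Rep` links its elements to pointwise expressions. -/

noncomputable section

namespace AnomalyFlow

/-! ### Matrices over an algebra with a derivation -/

/-- The derivative of a product of matrices of functions. -/
theorem map_mul_derivation {S n : Type*} [CommRing S] [Algebra ℂ S] [Fintype n]
    (d : Derivation ℂ S S) (M N : Matrix n n S) :
    (M * N).map d = M.map d * N + M * N.map d := by
  ext i j
  simp only [Matrix.map_apply, Matrix.mul_apply, Matrix.add_apply, map_sum, Derivation.leibniz,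
    smul_eq_mul, ← Finset.sum_add_distrib]
  exact Finset.sum_congr rfl fun _ _ => by ring

theorem map_add_derivation {S n : Type*} [CommRing S] [Algebra ℂ S]
    (d : Derivation ℂ S S) (M N : Matrix n n S) : (M + N).map d = M.map d + N.map d := by
  ext i j; simp

theorem map_neg_derivation {S n : Type*} [CommRing S] [Algebra ℂ S]
    (d : Derivation ℂ S S) (M : Matrix n n S) : (-M).map d = -M.map d := by
  ext i j; simp

theorem trace_map_derivation {S n : Type*} [CommRing S] [Algebra ℂ S] [Fintype n]
    (d : Derivation ℂ S S) (M : Matrix n n S) : (M.map d).trace = d M.trace := by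
  simp [Matrix.trace]

/-- The derivative of the inverse of a matrix of functions. -/
theorem map_inv_derivation {S n : Type*} [CommRing S] [Algebra ℂ S] [Fintype n] [DecidableEq n]
    (d : Derivation ℂ S S) {g h : Matrix n n S} (gh : g * h = 1) :
    h.map d = -(h * g.map d * h) := by
  have hg : h * g = 1 := mul_eq_one_comm.mp gh
  have h1 : (g * h).map d = 0 := by
    rw [gh]; ext i j; by_cases hij : i = j <;> simp [hij]
  rw [map_mul_derivation] at h1
  have h2 : h * (g * h.map d) = -(h * (g.map d * h)) := by
    rw [← mul_neg]; congr 1; exact eq_neg_of_add_eq_zero_right h1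
  rwa [← mul_assoc, hg, one_mul, ← mul_assoc] at h2

/-- Jacobi's formula for `3 × 3` matrices. -/
theorem derivation_det {S : Type*} [CommRing S] [Algebra ℂ S] (d : Derivation ℂ S S)
    {g h : Matrix (Fin 3) (Fin 3) S} (gh : g * h = 1) :
    d g.det = g.det * (h * g.map d).trace := by
  -- Replacing det g · g⁻¹ by the adjugate turns the claim into a polynomial identity in the entries
  -- of g and their derivatives.
  have e : g.adjugate = g.det • h := by
    calc g.adjugate = g.adjugate * (g * h) := by rw [gh, mul_one]
      _ = g.det • h := by rw [← mul_assoc, Matrix.adjugate_mul, smul_mul_assoc, one_mul]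
  have e2 : g.det * (h * g.map d).trace = (g.adjugate * g.map d).trace := by
    rw [e, smul_mul_assoc, Matrix.trace_smul, smul_eq_mul]
  rw [e2, Matrix.adjugate_fin_three, Matrix.det_fin_three]
  simp only [map_add, map_sub, Derivation.leibniz, smul_eq_mul, Matrix.trace, Matrix.diag,
    Matrix.mul_apply, Fin.sum_univ_three, Matrix.map_apply, Matrix.of_apply, Matrix.cons_val]
  ring

/-! ## Hermitian geometry over a ring with commuting derivations -/

/-- A commutative algebra with commuting derivations `∂_j`, `∂_k̄`, and an invertible matrix
`g k j = g_{k̄j}`. -/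
structure HermData (S : Type*) [CommRing S] [Algebra ℂ S] where
  dl : Fin 3 → Derivation ℂ S S
  dr : Fin 3 → Derivation ℂ S S
  g : Matrix (Fin 3) (Fin 3) S
  h : Matrix (Fin 3) (Fin 3) S
  comm_ll : ∀ i j s, dl i (dl j s) = dl j (dl i s)
  comm_lr : ∀ i j s, dl i (dr j s) = dr j (dl i s)
  comm_rr : ∀ i j s, dr i (dr j s) = dr j (dr i s)
  gh : g * h = 1

namespace HermData

variable {S : Type*} [CommRing S] [Algebra ℂ S] (H : HermData S)

theorem hg : H.h * H.g = 1 := mul_eq_one_comm.mp H.gh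

/-- The complex conjugate structure. -/
def swap : HermData S where
  dl := H.dr
  dr := H.dl
  g := H.g.transpose
  h := H.h.transpose
  comm_ll := H.comm_rr
  comm_lr i j s := (H.comm_lr j i s).symm
  comm_rr := H.comm_ll
  gh := by rw [← Matrix.transpose_mul, H.hg, Matrix.transpose_one]

/-! ### Connection, curvature, torsion and traces with respect to the metric -/

/-- Connection matrices `A j m q = A_{jq}^m`. -/
def A (j : Fin 3) : Matrix (Fin 3) (Fin 3) S := H.h * H.g.map (H.dl j)

/-- Curvature matrices `R k j p q = R_{k̄j}{}^p{}_q`. -/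
def R (k j : Fin 3) : Matrix (Fin 3) (Fin 3) S := -(H.A j).map (H.dr k)

/-- The curvature with lowered index. -/
def Rl (k j : Fin 3) : Matrix (Fin 3) (Fin 3) S := H.g * H.R k j

/-- The torsion `T_{p̄jq}`. -/
def T (p j q : Fin 3) : S := H.dl j (H.g p q) - H.dl q (H.g p j)

/-- The trace `h^{s r̄} X_{r̄ s}`. -/
def ctr (X : Fin 3 → Fin 3 → S) : S := ∑ s, ∑ r, H.h s r * X r s

/-- The contracted torsion `T_q`. -/
def tau (q : Fin 3) : S := H.ctr fun k j => H.T k j q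

theorem ctr_eq_trace (M : Matrix (Fin 3) (Fin 3) S) : H.ctr M = (H.h * M).trace := by
  simp [ctr, Matrix.trace, Matrix.mul_apply]

theorem sum_gh (p q : Fin 3) : ∑ s, H.g p s * H.h s q = if p = q then 1 else 0 := by
  have := congrFun (congrFun H.gh p) q
  rwa [Matrix.mul_apply, Matrix.one_apply] at this

theorem sum_hg (p q : Fin 3) : ∑ s, H.h p s * H.g s q = if p = q then 1 else 0 := by
  have := congrFun (congrFun H.hg p) q
  rwa [Matrix.mul_apply, Matrix.one_apply] at this

theorem ctr_add (X Y : Fin 3 → Fin 3 → S) :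
    H.ctr (fun r s => X r s + Y r s) = H.ctr X + H.ctr Y := by
  simp [ctr, mul_add, Finset.sum_add_distrib]

theorem ctr_sub (X Y : Fin 3 → Fin 3 → S) :
    H.ctr (fun r s => X r s - Y r s) = H.ctr X - H.ctr Y := by
  simp [ctr, mul_sub, Finset.sum_sub_distrib]

theorem ctr_mul (a : S) (X : Fin 3 → Fin 3 → S) :
    H.ctr (fun r s => a * X r s) = a * H.ctr X := by
  simp only [ctr, Finset.mul_sum]
  exact Finset.sum_congr rfl fun _ _ => Finset.sum_congr rfl fun _ _ => by ring

theorem ctr_g : H.ctr (fun r s => H.g r s) = 3 := by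
  simp [ctr, sum_hg]

theorem ctr_left (X : Fin 3 → S) (p : Fin 3) : H.ctr (fun r s => X r * H.g p s) = X p := by
  have : ∀ r, ∑ s, H.h s r * (X r * H.g p s) = X r * if p = r then 1 else 0 := fun r => by
    rw [← H.sum_gh, Finset.mul_sum]; exact Finset.sum_congr rfl fun _ _ => by ring
  rw [ctr, Finset.sum_comm]; simp [this]

theorem ctr_right (Y : Fin 3 → S) (q : Fin 3) : H.ctr (fun r s => H.g r q * Y s) = Y q := by
  have : ∀ s, ∑ r, H.h s r * (H.g r q * Y s) = (if s = q then 1 else 0) * Y s := fun s => by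
    rw [← H.sum_hg, Finset.sum_mul]; exact Finset.sum_congr rfl fun _ _ => by ring
  simp [ctr, this]

theorem A_apply (j m q : Fin 3) : H.A j m q = ∑ k, H.h m k * H.dl j (H.g k q) := by
  simp [A, Matrix.mul_apply]

theorem R_apply (k j p q : Fin 3) : H.R k j p q = -H.dr k (H.A j p q) := rfl

theorem g_mul_A (j : Fin 3) : H.g * H.A j = H.g.map (H.dl j) := by
  rw [A, ← mul_assoc, H.gh, one_mul]

theorem T_up (m j q : Fin 3) : ∑ k, H.h m k * H.T k j q = H.A j m q - H.A q m j := by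
  simp [A_apply, T, mul_sub]

theorem tau_eq (q : Fin 3) : H.tau q = ∑ m, (H.A m m q - H.A q m m) := by
  simp [tau, ctr, T_up]

theorem tau_eq_sub (q : Fin 3) :
    H.tau q = H.ctr (fun k j => H.dl j (H.g k q)) - H.ctr (fun k j => H.dl q (H.g k j)) := by
  rw [← ctr_sub]; rfl

theorem map_comm {d d' : Derivation ℂ S S} (hc : ∀ s, d (d' s) = d' (d s))
    (M : Matrix (Fin 3) (Fin 3) S) : (M.map d').map d = (M.map d).map d' := by
  ext i j; simp [hc]

/-! ### Bianchi identities and contractions of the curvature -/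

/-- The (2,0) part of the curvature vanishes. -/
theorem flat (j l : Fin 3) :
    (H.A l).map (H.dl j) + H.A j * H.A l = (H.A j).map (H.dl l) + H.A l * H.A j := by
  -- Since A = g⁻¹∂g, both sides reduce to g⁻¹ ∂_j∂_l g.
  have := map_comm (fun s => H.comm_ll j l s) H.g
  simp only [A, map_mul_derivation, map_inv_derivation _ H.gh, this]
  noncomm_ring

/-- The second Bianchi identity. -/
theorem bianchi (k j l : Fin 3) :
    (H.R k l).map (H.dl j) + H.A j * H.R k l - H.R k l * H.A j
      = (H.R k j).map (H.dl l) + H.A l * H.R k j - H.R k j * H.A l := by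
  -- The identity is ∂_k̄ applied to the flatness of the (2,0) part, because R_{k̄j} = -∂_k̄ A_j.
  have e := congrArg (fun M => Matrix.map M (H.dr k)) (H.flat j l)
  simp only [map_add_derivation, map_mul_derivation] at e
  rw [← map_comm (fun s => H.comm_lr j k s), ← map_comm (fun s => H.comm_lr l k s)] at e
  simp only [R, map_neg_derivation]
  rw [← sub_eq_zero] at e ⊢
  rw [← neg_eq_zero, ← e]
  noncomm_ring

/-- The curvature in terms of the metric. -/
theorem Rl_eq (k j : Fin 3) :
    H.Rl k j = H.g.map (H.dr k) * H.h * H.g.map (H.dl j) - (H.g.map (H.dl j)).map (H.dr k) := by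
  have e : H.g * H.h.map (H.dr k) = -(H.g.map (H.dr k) * H.h) := by
    rw [map_inv_derivation _ H.gh, mul_neg, ← mul_assoc, ← mul_assoc, H.gh, one_mul]
  rw [Rl, R, A, map_mul_derivation, mul_neg, mul_add, ← mul_assoc, ← mul_assoc, H.gh, one_mul, e]
  noncomm_ring

/-- The formula `Rl_eq` is invariant under transposition combined with the exchange of ∂ and ∂̄.
This is the Hermitian symmetry of the curvature; it turns every contraction identity into its
conjugate. -/
theorem swap_Rl (k j p q : Fin 3) : H.swap.Rl k j p q = H.Rl j k q p := by
  have e : H.swap.Rl k j = (H.Rl j k).transpose := by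
    rw [Rl_eq, Rl_eq]
    have := congrArg Matrix.transpose (map_comm (fun s => H.comm_lr k j s) H.g)
    simp only [← Matrix.transpose_map] at this
    simp only [swap, Matrix.transpose_sub, Matrix.transpose_mul, ← Matrix.transpose_map,
      ← mul_assoc, this]
  rw [e]; rfl

/-- The Ricci curvature `R_{k̄j}{}^s{}_s`. -/
def ric (k j : Fin 3) : S := (H.R k j).trace

theorem ctr_Rl (k j : Fin 3) : H.ctr (fun r s => H.Rl k j r s) = H.ric k j := by
  have : H.ctr (fun r s => H.Rl k j r s) = (H.h * H.Rl k j).trace := H.ctr_eq_trace _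
  rw [this, Rl, ← mul_assoc, H.hg, one_mul]; rfl

theorem swap_ric (k j : Fin 3) : H.swap.ric k j = H.ric j k := by
  rw [← ctr_Rl, ← ctr_Rl, ctr, ctr, Finset.sum_comm]
  simp only [swap_Rl]; rfl

theorem h_mul_Rl (k j : Fin 3) (s q : Fin 3) : ∑ r, H.h s r * H.Rl k j r q = H.R k j s q := by
  have : (H.h * H.Rl k j) s q = H.R k j s q := by rw [Rl, ← mul_assoc, H.hg, one_mul]
  rwa [Matrix.mul_apply] at this

/-- The contraction is -∂_p̄ A_{sq}^s while the Ricci curvature is -∂_p̄ A_{qs}^s, and A_{sq}^s -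
A_{qs}^s = T_q. -/
theorem ctr_Rl_right (p q : Fin 3) :
    H.ctr (fun r s => H.Rl p s r q) = H.ric p q - H.dr p (H.tau q) := by
  simp only [ctr, h_mul_Rl, tau_eq, ric, Matrix.trace, Matrix.diag, R_apply, map_sum, map_sub,
    Finset.sum_neg_distrib, Finset.sum_sub_distrib]
  ring

/-- The conjugate of `ctr_Rl_right`, by the Hermitian symmetry of the curvature. -/
theorem ctr_Rl_left (p q : Fin 3) :
    H.ctr (fun r s => H.Rl r q p s) = H.ric p q - H.dl q (H.swap.tau p) := by
  have := H.swap.ctr_Rl_right q p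
  rw [swap_ric, ctr, Finset.sum_comm] at this
  simp only [swap_Rl] at this
  exact this

/-! ### The trace of i∂∂̄ω -/

/-- The components of `i ∂∂̄ω`. -/
def K (p s r q : Fin 3) : S :=
  H.dl q (H.dr p (H.g r s)) - H.dl q (H.dr r (H.g p s)) - H.dl s (H.dr p (H.g r q))
    + H.dl s (H.dr r (H.g p q))

/-- `(T T̄)_{p̄q}`. -/
def TT (p q : Fin 3) : S :=
  ∑ s, ∑ r, ∑ m, ∑ l, H.h s r * H.h m l * H.T r m q * H.swap.T s l p

theorem Rl_apply (k j p q : Fin 3) : H.Rl k j p q =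
    (∑ a, ∑ b, H.h a b * (H.dr k (H.g p a) * H.dl j (H.g b q))) - H.dl j (H.dr k (H.g p q)) := by
  rw [Rl_eq, Matrix.sub_apply, mul_assoc]
  simp only [Matrix.mul_apply, Matrix.map_apply, H.comm_lr, Finset.mul_sum]
  congr 1
  exact Finset.sum_congr rfl fun _ _ => Finset.sum_congr rfl fun _ _ => by ring

/-- By `Rl_apply` each second derivative of g is a curvature term plus a product of first
derivatives. The four products combine into a single product of T and its conjugate. -/
theorem K_eq (p s r q : Fin 3) : H.K p s r q =
    -H.Rl p q r s + H.Rl r q p s + H.Rl p s r q - H.Rl r s p q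
      + ∑ a, ∑ b, H.h a b * (H.T b s q * H.swap.T a r p) := by
  have e : ∑ a, ∑ b, H.h a b * (H.T b s q * H.swap.T a r p) =
      (∑ a, ∑ b, H.h a b * (H.dr p (H.g r a) * H.dl q (H.g b s)))
      - (∑ a, ∑ b, H.h a b * (H.dr r (H.g p a) * H.dl q (H.g b s)))
      - (∑ a, ∑ b, H.h a b * (H.dr p (H.g r a) * H.dl s (H.g b q)))
      + (∑ a, ∑ b, H.h a b * (H.dr r (H.g p a) * H.dl s (H.g b q))) := by
    simp only [← Finset.sum_sub_distrib, ← Finset.sum_add_distrib]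
    refine Finset.sum_congr rfl fun _ _ => Finset.sum_congr rfl fun _ _ => ?_
    simp only [T, swap, Matrix.transpose_apply]; ring
  rw [e, K]; simp only [Rl_apply]; ring

/-- `R̃_{p̄q} = g^{λ μ̄} R_{μ̄ λ p̄ q}`. -/
def Rt (p q : Fin 3) : S := H.ctr fun μ lam => H.Rl μ lam p q

theorem ctr_TT (p q : Fin 3) :
    H.ctr (fun r s => ∑ a, ∑ b, H.h a b * (H.T b s q * H.swap.T a r p)) = H.TT p q := by
  simp only [ctr, TT, Finset.mul_sum]
  have : ∀ s a : Fin 3, ∑ r, ∑ b, H.h s r * (H.h a b * (H.T b s q * H.swap.T a r p))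
      = ∑ b, ∑ r, H.h a b * H.h s r * H.T b s q * H.swap.T a r p := fun s a => by
    rw [Finset.sum_comm]
    exact Finset.sum_congr rfl fun _ _ => Finset.sum_congr rfl fun _ _ => by ring
  calc _ = ∑ s, ∑ a, ∑ r, ∑ b, H.h s r * (H.h a b * (H.T b s q * H.swap.T a r p)) :=
        Finset.sum_congr rfl fun _ _ => Finset.sum_comm
    _ = _ := by
        simp only [this]
        rw [Finset.sum_comm]
        exact Finset.sum_congr rfl fun _ _ => Finset.sum_comm

/-- The trace of `i ∂∂̄ω`, for a metric with `2 ∂_p̄ T_q = R_{p̄q}` and its conjugate. -/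
theorem ctr_K (h1 : ∀ p q, 2 * H.dr p (H.tau q) = H.ric p q)
    (h2 : ∀ p q, 2 * H.dl q (H.swap.tau p) = H.ric p q) (p q : Fin 3) :
    H.ctr (fun r s => H.K p s r q) = -H.Rt p q + H.TT p q := by
  have two : ∀ x y : S, (2 : S) * x = 2 * y → x = y := fun x y hxy => by
    have := congrArg (fun w => (1 / 2 : ℂ) • w) hxy
    simpa [two_mul, ← two_smul ℂ, smul_smul] using this
  have e : H.ctr (fun r s => H.K p s r q) = -H.ctr (fun r s => H.Rl p q r s)
      + H.ctr (fun r s => H.Rl r q p s) + H.ctr (fun r s => H.Rl p s r q) - H.Rt p q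
      + H.TT p q := by
    rw [← ctr_TT, Rt, show ∀ x : S, -x = (-1) * x from fun x => by ring, ← ctr_mul,
      ← ctr_add, ← ctr_add, ← ctr_sub, ← ctr_add]
    congr 1; funext r s; rw [K_eq]; ring
  -- The three contractions other than R̃ add up to Ric - ∂_q T̄_p - ∂_p̄ T_q, which vanishes
  -- because each derivative is half of Ric.
  rw [e, ctr_Rl, ctr_Rl_left, ctr_Rl_right]
  apply two
  linear_combination -h1 p q - h2 p q

/-! ### The form ω² and the conformally balanced condition -/

/-- The components of `ω² / 2`. -/
def b (q s p r : Fin 3) : S := H.g p q * H.g r s - H.g r q * H.g p s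

/-- The trace of the derivative of `N ω²`. -/
theorem ctr_derivation_b (d : Derivation ℂ S S) (N : S)
    (hN : 2 * d N + N * H.ctr (fun r s => d (H.g r s)) = 0) (p q : Fin 3) :
    H.ctr (fun r s => 2 * d (N * H.b q s p r)) = 2 * N * d (H.g p q) := by
  have e : H.ctr (fun r s => 2 * d (N * H.b q s p r)) =
      2 * d N * H.g p q * H.ctr (fun r s => H.g r s)
        - 2 * d N * H.ctr (fun r s => H.g r q * H.g p s)
        + 2 * N * d (H.g p q) * H.ctr (fun r s => H.g r s)
        + 2 * N * H.g p q * H.ctr (fun r s => d (H.g r s))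
        - 2 * N * H.ctr (fun r s => d (H.g r q) * H.g p s)
        - 2 * N * H.ctr (fun r s => H.g r q * d (H.g p s)) := by
    simp only [← ctr_mul, ← ctr_add, ← ctr_sub, b]
    congr 1; funext r s
    simp only [Derivation.leibniz, map_sub, smul_eq_mul]; ring
  rw [e, ctr_g, H.ctr_left (fun r => H.g r q), H.ctr_left (fun r => d (H.g r q)),
    H.ctr_right (fun s => d (H.g p s))]
  -- The terms not proportional to d g_{p̄q} form 2 g_{p̄q} times the left side of `hN`.
  linear_combination 2 * H.g p q * hN

/-- For a conformally balanced metric, `∂_m N = N T_m`. -/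
theorem dl_eq_of_balanced (N : S)
    (hB : ∀ m q s p r, H.dl m (N * H.b q s p r) - H.dl q (N * H.b m s p r)
      + H.dl s (N * H.b m q p r) = 0) (m : Fin 3) : H.dl m N = N * H.tau m := by
  have two : ∀ x : S, (2 : S) * x = 0 → x = 0 := fun x hxy => by
    have := congrArg (fun w => (1 / 2 : ℂ) • w) hxy
    simpa [two_mul, ← two_smul ℂ, smul_smul] using this
  -- With v_m = ∂_m N - N T_m, one contraction of the balanced condition gives v_m g_{p̄q} = v_q
  -- g_{p̄m}. A second contraction gives 3 v_m = v_m, so v = 0.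
  have e : ∀ q p, (H.dl m N - N * H.tau m) * H.g p q = (H.dl q N - N * H.tau q) * H.g p m := by
    intro q p
    have e1 : H.ctr (fun r s => H.dl m (N * H.b q s p r) - H.dl q (N * H.b m s p r)
        + H.dl s (N * H.b m q p r)) = 
        H.dl m N * H.g p q * H.ctr (fun r s => H.g r s)
        - H.dl m N * H.ctr (fun r s => H.g r q * H.g p s)
        + N * H.dl m (H.g p q) * H.ctr (fun r s => H.g r s)
        + N * H.g p q * H.ctr (fun r s => H.dl m (H.g r s))
        - N * H.ctr (fun r s => H.dl m (H.g r q) * H.g p s)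
        - N * H.ctr (fun r s => H.g r q * H.dl m (H.g p s))
        - (H.dl q N * H.g p m * H.ctr (fun r s => H.g r s)
        - H.dl q N * H.ctr (fun r s => H.g r m * H.g p s)
        + N * H.dl q (H.g p m) * H.ctr (fun r s => H.g r s)
        + N * H.g p m * H.ctr (fun r s => H.dl q (H.g r s))
        - N * H.ctr (fun r s => H.dl q (H.g r m) * H.g p s)
        - N * H.ctr (fun r s => H.g r m * H.dl q (H.g p s)))
        + (H.g p m * H.ctr (fun r s => H.g r q * H.dl s N)
        - H.g p q * H.ctr (fun r s => H.g r m * H.dl s N)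
        + N * H.ctr (fun r s => H.g r q * H.dl s (H.g p m))
        + N * H.g p m * H.ctr (fun r s => H.dl s (H.g r q))
        - N * H.g p q * H.ctr (fun r s => H.dl s (H.g r m))
        - N * H.ctr (fun r s => H.g r m * H.dl s (H.g p q))) := by
      simp only [← ctr_mul, ← ctr_add, ← ctr_sub, b]
      congr 1; funext r s
      simp only [Derivation.leibniz, map_sub, smul_eq_mul]; ring
    have e0 : H.ctr (fun r s => H.dl m (N * H.b q s p r) - H.dl q (N * H.b m s p r)
        + H.dl s (N * H.b m q p r)) = 0 := by
      simp only [hB]; simp [ctr]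
    rw [e0, ctr_g, H.ctr_left (fun r => H.g r q), H.ctr_left (fun r => H.dl m (H.g r q)),
      H.ctr_right (fun s => H.dl m (H.g p s)), H.ctr_left (fun r => H.g r m),
      H.ctr_left (fun r => H.dl q (H.g r m)), H.ctr_right (fun s => H.dl q (H.g p s)),
      H.ctr_right (fun s => H.dl s N), H.ctr_right (fun s => H.dl s N),
      H.ctr_right (fun s => H.dl s (H.g p m)), H.ctr_right (fun s => H.dl s (H.g p q))] at e1
    rw [tau_eq_sub, tau_eq_sub]
    linear_combination -e1
  have e2 : H.ctr (fun p q => (H.dl m N - N * H.tau m) * H.g p q)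
      = H.ctr (fun p q => H.g p m * (H.dl q N - N * H.tau q)) := by
    congr 1; funext p q; rw [e q p, mul_comm]
  rw [H.ctr_mul _ fun p q => H.g p q, ctr_g, H.ctr_right (fun q => H.dl q N - N * H.tau q)] at e2
  refine sub_eq_zero.mp (two _ ?_)
  linear_combination e2

end HermData

theorem derivation_two {S : Type*} [CommRing S] [Algebra ℂ S] (d : Derivation ℂ S S) :
    d (2 : S) = 0 := by
  exact_mod_cast d.map_natCast 2

theorem derivation_six {S : Type*} [CommRing S] [Algebra ℂ S] (d : Derivation ℂ S S) :
    d (6 : S) = 0 := by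
  exact_mod_cast d.map_natCast 6

namespace HermData

variable {S : Type*} [CommRing S] [Algebra ℂ S] (H : HermData S)

/-! ### Closedness of Tr(Rm ∧ Rm) and of i∂∂̄ω -/

/-- The covariant derivative `∂_m R_{k̄j} + [A_m, R_{k̄j}]` of the curvature form. -/
def DR (m k j : Fin 3) : Matrix (Fin 3) (Fin 3) S :=
  (H.R k j).map (H.dl m) + H.A m * H.R k j - H.R k j * H.A m

theorem DR_comm (m k j : Fin 3) : H.DR m k j = H.DR j k m := H.bianchi k m j

/-- The trace kills the commutator with A_m, so ordinary derivatives may be replaced by covariant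
ones, to which the Bianchi identity applies. -/
theorem dl_trace_mul (m k j k' j' : Fin 3) : H.dl m (H.R k j * H.R k' j').trace
    = (H.DR m k j * H.R k' j').trace + (H.R k j * H.DR m k' j').trace := by
  have e : (H.A m * (H.R k j * H.R k' j')).trace = (H.R k j * H.R k' j' * H.A m).trace :=
    Matrix.trace_mul_comm _ _
  rw [← trace_map_derivation, map_mul_derivation]
  simp only [DR, add_mul, sub_mul, mul_add, mul_sub, Matrix.trace_add, Matrix.trace_sub, mul_assoc]
    at e ⊢
  linear_combination -e

theorem dr_trace_mul (m k j k' j' : Fin 3) : H.dr m (H.R k j * H.R k' j').trace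
    = ((H.R k j).map (H.dr m) * H.R k' j').trace + (H.R k j * (H.R k' j').map (H.dr m)).trace := by
  rw [← trace_map_derivation, map_mul_derivation, Matrix.trace_add]

/-- The barred Bianchi identity: R_{k̄j} = -∂_k̄ A_j and barred derivatives commute. No connection
term occurs in a holomorphic frame. -/
theorem dr_R_comm (m k j : Fin 3) : (H.R k j).map (H.dr m) = (H.R m j).map (H.dr k) := by
  simp only [R, map_neg_derivation]
  rw [map_comm (fun s => H.comm_rr m k s)]

/-- The components of `Tr (Rm ∧ Rm)`. -/
def trRR (p s r q : Fin 3) : S :=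
  2 * ((H.R p s * H.R r q).trace - (H.R p q * H.R r s).trace)

/-- After the product rule there are twelve traces; the symmetry of `DR` in its two unbarred indices
makes them cancel in pairs. -/
theorem trRR_closed_left (m q s p r : Fin 3) :
    H.dl m (H.trRR p s r q) - H.dl q (H.trRR p s r m) + H.dl s (H.trRR p q r m) = 0 := by
  simp only [trRR, Derivation.leibniz, map_sub, dl_trace_mul, smul_eq_mul,
    derivation_two]
  rw [H.DR_comm q p s, H.DR_comm m p s, H.DR_comm m p q, H.DR_comm q r s, H.DR_comm m r s,
    H.DR_comm m r q]
  ring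

theorem trRR_closed_right (m q s p r : Fin 3) :
    H.dr m (H.trRR p s r q) - H.dr p (H.trRR m s r q) + H.dr r (H.trRR m s p q) = 0 := by
  simp only [trRR, Derivation.leibniz, map_sub, dr_trace_mul, smul_eq_mul,
    derivation_two]
  rw [H.dr_R_comm m p s, H.dr_R_comm m p q, H.dr_R_comm m r s, H.dr_R_comm m r q,
    H.dr_R_comm p r s, H.dr_R_comm p r q]
  -- Two of the cancelling pairs contain the same factors in opposite order.
  linear_combination
    2 * Matrix.trace_mul_comm (H.R p s) ((H.R m q).map (H.dr r))
      - 2 * Matrix.trace_mul_comm (H.R p q) ((H.R m s).map (H.dr r))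

theorem K_closed_left (m q s p r : Fin 3) :
    H.dl m (H.K p s r q) - H.dl q (H.K p s r m) + H.dl s (H.K p q r m) = 0 := by
  simp only [K, map_sub, map_add]
  rw [H.comm_ll q m, H.comm_ll q m, H.comm_ll s m, H.comm_ll s m, H.comm_ll s q, H.comm_ll s q]
  ring

theorem K_closed_right (m q s p r : Fin 3) :
    H.dr m (H.K p s r q) - H.dr p (H.K m s r q) + H.dr r (H.K m s p q) = 0 := by
  simp only [K, map_sub, map_add, ← H.comm_lr]
  rw [H.comm_rr p m, H.comm_rr p m, H.comm_rr r m, H.comm_rr r m, H.comm_rr r p, H.comm_rr r p]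
  ring

/-! ### Covariant derivatives of torsion and curvature -/

/-- `∇_μ̄ T_{p̄jq}`. -/
def Z (μ p j q : Fin 3) : S := H.dr μ (H.T p j q) - ∑ c, H.swap.A μ c p * H.T c j q

theorem T_eq (p j q : Fin 3) : H.T p j q = ∑ l, H.g p l * (H.A j l q - H.A q l j) := by
  have e : ∀ j q, ∑ l, H.g p l * H.A j l q = H.dl j (H.g p q) := fun j q => by
    have := congrFun (congrFun (H.g_mul_A j) p) q
    rwa [Matrix.mul_apply] at this
  simp only [mul_sub, Finset.sum_sub_distrib, e]; rfl

theorem swap_A_apply (μ c p : Fin 3) : H.swap.A μ c p = ∑ k, H.h k c * H.dr μ (H.g p k) :=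
  H.swap.A_apply μ c p

/-- The first Bianchi identity. -/
theorem Z_eq (μ p j q : Fin 3) : H.Z μ p j q = H.Rl μ q p j - H.Rl μ j p q := by
  -- The torsion is g times the antisymmetrized connection. The derivative falling on g cancels the
  -- connection term of ∇_μ̄, and the derivative falling on A is minus the curvature.
  have e1 : H.dr μ (H.T p j q) = ∑ l, H.g p l * H.dr μ (H.A j l q - H.A q l j)
      + ∑ l, (H.A j l q - H.A q l j) * H.dr μ (H.g p l) := by
    rw [T_eq, map_sum, ← Finset.sum_add_distrib]
    exact Finset.sum_congr rfl fun _ _ => Derivation.leibniz _ _ _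
  have e2 : ∑ c, H.swap.A μ c p * H.T c j q
      = ∑ l, (H.A j l q - H.A q l j) * H.dr μ (H.g p l) := by
    simp only [← T_up, swap_A_apply, Finset.sum_mul]
    rw [Finset.sum_comm]
    exact Finset.sum_congr rfl fun _ _ => Finset.sum_congr rfl fun _ _ => by ring
  rw [Z, e1, e2, add_sub_cancel_right]
  simp only [Rl, Matrix.mul_apply, R_apply, ← Finset.sum_sub_distrib, map_sub]
  exact Finset.sum_congr rfl fun _ _ => by ring

/-- `∇_j R_{μ̄λp̄q}`. -/
def nablaRl (j μ lam p q : Fin 3) : S :=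
  H.dl j (H.Rl μ lam p q) - ∑ c, H.A j c lam * H.Rl μ c p q - ∑ c, H.A j c q * H.Rl μ lam p c

/-- Because g is parallel, lowering an endomorphism index commutes with ∇. The full covariant
derivative thus differs from `DR` only by the connection term on the form index λ, which is the
source of the torsion in `nablaRl_comm`. -/
theorem nablaRl_eq (j μ lam p q : Fin 3) :
    H.nablaRl j μ lam p q = (H.g * H.DR j μ lam) p q - ∑ c, H.A j c lam * H.Rl μ c p q := by
  have e : (H.g * H.DR j μ lam) = (H.Rl μ lam).map (H.dl j) - H.Rl μ lam * H.A j := by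
    rw [DR, Rl, map_mul_derivation, ← g_mul_A]; noncomm_ring
  rw [e, nablaRl, Matrix.sub_apply, Matrix.mul_apply, Matrix.map_apply]
  simp only [mul_comm (H.A j _ q)]
  ring

/-- The second Bianchi identity for the covariant derivatives of the curvature. -/
theorem nablaRl_comm (j μ lam p q : Fin 3) :
    H.nablaRl j μ lam p q = H.nablaRl lam μ j p q
      - ∑ c, (H.A j c lam - H.A lam c j) * H.Rl μ c p q := by
  rw [nablaRl_eq, nablaRl_eq, H.DR_comm j μ lam]
  simp only [sub_mul, Finset.sum_sub_distrib]
  ring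

/-- The metric is parallel. -/
theorem dl_ctr (j : Fin 3) (X : Fin 3 → Fin 3 → S) :
    H.dl j (H.ctr X) = H.ctr fun r s => H.dl j (X r s) - ∑ c, H.A j c s * X r c := by
  -- This is ∂_j g⁻¹ = -A_j g⁻¹; barred indices acquire no connection term under ∇_j.
  have e : ∀ s r, H.dl j (H.h s r) = -∑ c, H.A j s c * H.h c r := fun s r => by
    have := congrFun (congrFun (map_inv_derivation (H.dl j) H.gh) s) r
    rwa [Matrix.map_apply, Matrix.neg_apply, ← A, Matrix.mul_apply] at this
  have e2 : ∑ s, ∑ r, X r s * H.dl j (H.h s r) = -∑ s, ∑ r, H.h s r * ∑ c, H.A j c s * X r c := by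
    simp only [e, Finset.mul_sum, ← Finset.sum_neg_distrib, mul_neg]
    rw [Finset.sum_comm, Finset.sum_comm (γ := Fin 3) (s := Finset.univ) (t := Finset.univ)
      (f := fun s r => ∑ c, -(H.h s r * (H.A j c s * X r c)))]
    refine Finset.sum_congr rfl fun r _ => ?_
    rw [Finset.sum_comm]
    exact Finset.sum_congr rfl fun _ _ => Finset.sum_congr rfl fun _ _ => by ring
  simp only [ctr, map_sum, Derivation.leibniz, smul_eq_mul, Finset.sum_add_distrib, mul_sub,
    Finset.sum_sub_distrib, e2]
  ring

/-- `g^{s r̄} ∇_j E_{p̄ s r̄ q}`. -/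
def nablaE (E : Fin 3 → Fin 3 → Fin 3 → Fin 3 → S) (j p q : Fin 3) : S :=
  H.ctr fun r s => H.dl j (E p s r q) - ∑ c, H.A j c s * E p c r q - ∑ c, H.A j c q * E p s r c

/-- `∇_j F_{p̄q}`. -/
def nabla2 (F : Fin 3 → Fin 3 → S) (j p q : Fin 3) : S :=
  H.dl j (F p q) - ∑ c, H.A j c q * F p c

/-- `g^{λ μ̄} ∇_λ ∇_μ̄ T_{p̄jq}`. -/
def lap (p j q : Fin 3) : S :=
  H.ctr fun μ lam => H.dl lam (H.Z μ p j q) - ∑ c, H.A lam c q * H.Z μ p j c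
    - ∑ c, H.A lam c j * H.Z μ p c q

theorem sum_mul_ctr (a : Fin 3 → S) (X : Fin 3 → Fin 3 → Fin 3 → S) :
    ∑ c, a c * H.ctr (X c) = H.ctr fun r s => ∑ c, a c * X c r s := by
  simp only [← ctr_mul]
  simp only [ctr, Finset.mul_sum]
  rw [Finset.sum_comm]
  exact Finset.sum_congr rfl fun _ _ => Finset.sum_comm

theorem nabla2_ctr (E : Fin 3 → Fin 3 → Fin 3 → Fin 3 → S) (j p q : Fin 3) :
    H.nabla2 (fun p q => H.ctr fun r s => E p s r q) j p q = H.nablaE E j p q := by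
  rw [nabla2, dl_ctr, sum_mul_ctr, ← ctr_sub]
  rfl

theorem nabla2_Rt (j p q : Fin 3) :
    H.nabla2 H.Rt j p q = H.ctr fun μ lam => H.nablaRl j μ lam p q := by
  show H.nabla2 (fun p q => H.ctr fun μ lam => H.Rl μ lam p q) j p q = _
  rw [nabla2, dl_ctr, sum_mul_ctr, ← ctr_sub]
  rfl

/-- `R^λ{}_{r p̄ j}`. -/
def Rup (lam r p j : Fin 3) : S := ∑ μ, H.h lam μ * H.Rl μ r p j

theorem ctr_torsion_Rl (j p q : Fin 3) :
    H.ctr (fun μ lam => ∑ c, (H.A j c lam - H.A lam c j) * H.Rl μ c p q)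
      = ∑ r, ∑ l, (H.A j r l - H.A l r j) * H.Rup l r p q := by
  simp only [ctr, Rup, Finset.mul_sum]
  have : ∀ l, ∑ r, ∑ c, H.h l r * ((H.A j c l - H.A l c j) * H.Rl r c p q)
      = ∑ c, ∑ r, (H.A j c l - H.A l c j) * (H.h l r * H.Rl r c p q) := fun l => by
    rw [Finset.sum_comm]
    exact Finset.sum_congr rfl fun _ _ => Finset.sum_congr rfl fun _ _ => by ring
  simp only [this]
  exact Finset.sum_comm

/-- The antisymmetrized derivative of `R̃` is the Laplacian of the torsion, up to lower order. -/
theorem nabla2_Rt_antisymm (j p q : Fin 3) :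
    -H.nabla2 H.Rt j p q + H.nabla2 H.Rt q p j = H.lap p j q
      - ((∑ r, ∑ l, (H.A q r l - H.A l r q) * H.Rup l r p j)
        - ∑ r, ∑ l, (H.A j r l - H.A l r j) * H.Rup l r p q) := by
  -- By the first Bianchi identity ∇_μ̄ T_{p̄jq} is a difference of two curvature components, so the
  -- Laplacian traces their derivatives ∇_λ.
  have e : H.lap p j q = H.ctr (fun μ lam => H.nablaRl lam μ q p j)
      - H.ctr (fun μ lam => H.nablaRl lam μ j p q) := by
    rw [← ctr_sub, lap]
    congr 1; funext μ lam
    simp only [nablaRl, Z_eq, map_sub, mul_sub, Finset.sum_sub_distrib]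
    ring
  -- The second Bianchi identity exchanges j with the contracted index λ.
  have e2 : ∀ j q, H.nabla2 H.Rt j p q = H.ctr (fun μ lam => H.nablaRl lam μ j p q)
      - ∑ r, ∑ l, (H.A j r l - H.A l r j) * H.Rup l r p q := fun j q => by
    rw [nabla2_Rt, ← ctr_torsion_Rl, ← ctr_sub]
    congr 1; funext μ lam
    exact H.nablaRl_comm j μ lam p q
  rw [e, e2, e2]; ring

/-! ### The evolution identity over the ring -/

/-- The evolution of the torsion for `2 ∂_t (N ω² / 2) = i ∂∂̄ω - E`. -/
theorem evolution_torsion (dt : Derivation ℂ S S) (hc : ∀ j s, dt (H.dl j s) = H.dl j (dt s))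
    (N : S) (E : Fin 3 → Fin 3 → Fin 3 → Fin 3 → S) (Ψ : Fin 3 → Fin 3 → S)
    (hE : ∀ p s r q, 2 * dt (N * H.b q s p r) = H.K p s r q - E p s r q)
    (hΨ : ∀ p q, Ψ p q = H.ctr fun r s => 2 * dt (N * H.b q s p r))
    (hNt : 2 * dt N + N * H.ctr (fun r s => dt (H.g r s)) = 0)
    (hNl : ∀ m, H.dl m N = N * H.tau m)
    (h1 : ∀ p q, 2 * H.dr p (H.tau q) = H.ric p q)
    (h2 : ∀ p q, 2 * H.dl q (H.swap.tau p) = H.ric p q) (p j q : Fin 3) :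
    2 * N * dt (H.T p j q) = (H.lap p j q - H.nablaE E j p q + H.nablaE E q p j)
      + ((∑ m, (∑ k, H.h m k * H.T k j q) * Ψ p m) - H.tau j * Ψ p q + H.tau q * Ψ p j
        + H.nabla2 H.TT j p q - H.nabla2 H.TT q p j)
      - ((∑ r, ∑ l, (∑ k, H.h r k * H.T k q l) * H.Rup l r p j)
        - ∑ r, ∑ l, (∑ k, H.h r k * H.T k j l) * H.Rup l r p q) := by
  have hg : ∀ p q, Ψ p q = 2 * N * dt (H.g p q) := fun p q => by
    rw [hΨ, ctr_derivation_b _ _ _ hNt]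
  -- Differentiating Ψ = 2N ∂_t g and using ∂_j N = N T_j produces the terms with the contracted
  -- torsion.
  have hd : ∀ j q, 2 * N * H.dl j (dt (H.g p q)) = H.dl j (Ψ p q) - H.tau j * Ψ p q := by
    intro j q
    simp only [hg, Derivation.leibniz, smul_eq_mul, hNl, derivation_two]
    ring
  -- The same trace, computed from the right side of the flow.
  have hs : ∀ p q, Ψ p q = -H.Rt p q + H.TT p q - H.ctr (fun r s => E p s r q) := by
    intro p q
    rw [hΨ, ← H.ctr_K h1 h2, ← ctr_sub]
    congr 1; funext r s; exact hE p s r q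
  -- The connection term left over here becomes T^m_{jq} Ψ_{p̄m} after antisymmetrization in j and
  -- q.
  have hn : ∀ j q, H.dl j (Ψ p q) = -H.nabla2 H.Rt j p q + H.nabla2 H.TT j p q
      - H.nablaE E j p q + ∑ c, H.A j c q * Ψ p c := by
    intro j q
    rw [← nabla2_ctr]
    simp only [hs, nabla2, map_add, map_sub, map_neg, mul_add, mul_sub, mul_neg,
      Finset.sum_add_distrib, Finset.sum_sub_distrib, Finset.sum_neg_distrib]
    ring
  have e := H.nabla2_Rt_antisymm j p q
  have eT : 2 * N * dt (H.T p j q) = 2 * N * H.dl j (dt (H.g p q))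
      - 2 * N * H.dl q (dt (H.g p j)) := by
    rw [T, map_sub, hc, hc]; ring
  rw [eT, hd, hd, hn, hn]
  simp only [T_up, sub_mul, Finset.sum_sub_distrib] at e ⊢
  linear_combination e

/-! ### The volume form and the Ricci curvature -/

/-- The logarithmic derivatives of a function `N` with `6 N² det g = f f̄`. -/
theorem derivation_of_sq_mul_det (d : Derivation ℂ S S) {N Ni F : S} (hNi : N * Ni = 1)
    (hN : N * N * H.g.det * 6 = F) :
    d F = F * (2 * (Ni * d N) + H.ctr fun r s => d (H.g r s)) := by
  have e : H.ctr (fun r s => d (H.g r s)) = (H.h * H.g.map d).trace := H.ctr_eq_trace _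
  rw [e, ← hN]
  simp only [Derivation.leibniz, smul_eq_mul, derivation_six, derivation_det d H.gh]
  linear_combination (-12 * N * H.g.det * d N) * hNi

/-- The trace is tr A_q, that is ∂_q log det g, and R_{p̄q} = -∂_p̄ A_q. -/
theorem dr_ctr_dl (p q : Fin 3) :
    H.dr p (H.ctr fun r s => H.dl q (H.g r s)) = -H.ric p q := by
  have : H.ctr (fun r s => H.dl q (H.g r s)) = (H.A q).trace := H.ctr_eq_trace _
  rw [this, ← trace_map_derivation, ric, R, Matrix.trace_neg, neg_neg]

/-- If `6 N² det g = f f̄` with `f` holomorphic and without zeros, the Ricci curvature is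
`2 ∂_p̄ ∂_q log N`. -/
theorem dr_log_eq_ric {N Ni f fi fb : S} (hNi : N * Ni = 1) (hf : f * fi = 1)
    (hF : IsUnit (f * fb)) (hN : N * N * H.g.det * 6 = f * fb) (hfr : ∀ k, H.dr k f = 0)
    (hfl : ∀ k, H.dl k fb = 0) (p q : Fin 3) : 2 * H.dr p (Ni * H.dl q N) = H.ric p q := by
  have e1 := H.derivation_of_sq_mul_det (H.dl q) hNi hN
  have e2 : H.dl q (f * fb) = f * fb * (fi * H.dl q f) := by
    simp only [Derivation.leibniz, hfl, smul_eq_mul]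
    linear_combination (-fb * H.dl q f) * hf
  rw [e2] at e1
  -- Cancelling f f̄ leaves ∂_q log f = 2 ∂_q log N + ∂_q log det g. Its left side is holomorphic,
  -- so ∂_p̄ annihilates it.
  have e3 := congrArg (H.dr p) (hF.mul_left_cancel e1)
  have hfi : H.dr p fi = 0 := by
    have := congrArg (H.dr p) hf
    simp only [Derivation.leibniz, hfr, smul_eq_mul, Derivation.map_one_eq_zero, mul_zero,
      add_zero] at this
    linear_combination fi * this - H.dr p fi * hf
  have hfq : H.dr p (H.dl q f) = 0 := by rw [← H.comm_lr, hfr, map_zero]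
  rw [map_add, dr_ctr_dl] at e3
  simp only [Derivation.leibniz, hfi, hfq, smul_eq_mul, derivation_two] at e3 ⊢
  linear_combination -e3

end HermData

/-! ## The ring of smooth functions on a set -/

section SmoothFun

theorem extend_val {E : Type*} {W : Set E} (f : W → ℂ) {w : E} (hw : w ∈ W) :
    Function.extend Subtype.val f 0 w = f ⟨w, hw⟩ :=
  Subtype.val_injective.extend_apply f 0 ⟨w, hw⟩

variable {E : Type*} [NormedAddCommGroup E] [NormedSpace ℝ E]

/-- The algebra of complex functions on `W` that are smooth within `W`. -/
def smoothSubalgebra (W : Set E) : Subalgebra ℂ (W → ℂ) where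
  carrier := {f | ContDiffOn ℝ ∞ (Function.extend Subtype.val f 0) W}
  mul_mem' {f g} hf hg := (ContDiffOn.mul hf hg).congr fun w hw => by
    simp only [extend_val _ hw, Pi.mul_apply]
  add_mem' {f g} hf hg := (ContDiffOn.add hf hg).congr fun w hw => by
    simp only [extend_val _ hw, Pi.add_apply]
  algebraMap_mem' c := (contDiffOn_const (c := c)).congr fun w hw => by
    simp only [extend_val _ hw, Pi.algebraMap_apply]; rfl

/-- The ring of complex functions on `W` that are smooth within `W`. -/
def SmoothFun (W : Set E) : Type _ := smoothSubalgebra W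

instance (W : Set E) : CommRing (SmoothFun W) := inferInstanceAs (CommRing (smoothSubalgebra W))

instance (W : Set E) : Algebra ℂ (SmoothFun W) :=
  inferInstanceAs (Algebra ℂ (smoothSubalgebra W))

namespace SmoothFun

variable {W : Set E}

/-- The extension of a smooth function by zero. -/
def ext (s : SmoothFun W) : E → ℂ := Function.extend Subtype.val s.1 0

theorem contDiffOn_ext (s : SmoothFun W) : ContDiffOn ℝ ∞ s.ext W := s.2

/-- The restriction to `W` of a function that is smooth within `W`. -/
def ofFun (F : E → ℂ) (hF : ContDiffOn ℝ ∞ F W) : SmoothFun W :=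
  ⟨fun w => F w, hF.congr fun w hw => by simp only [extend_val _ hw]⟩

theorem ext_ofFun (F : E → ℂ) (hF : ContDiffOn ℝ ∞ F W) {w : E} (hw : w ∈ W) :
    (ofFun F hF).ext w = F w := extend_val _ hw

theorem eq_of_ext {s s' : SmoothFun W} (h : ∀ w ∈ W, s.ext w = s'.ext w) : s = s' := by
  apply Subtype.ext
  funext w
  have := h w.1 w.2
  rwa [ext, ext, extend_val _ w.2, extend_val _ w.2] at this

section

variable {w : E} (hw : w ∈ W) (s s' : SmoothFun W)
include hw

theorem ext_add : (s + s').ext w = s.ext w + s'.ext w := by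
  simp only [ext, extend_val _ hw]; rfl

theorem ext_mul : (s * s').ext w = s.ext w * s'.ext w := by
  simp only [ext, extend_val _ hw]; rfl

theorem ext_sub : (s - s').ext w = s.ext w - s'.ext w := by
  simp only [ext, extend_val _ hw]; rfl

theorem ext_neg : (-s).ext w = -s.ext w := by
  simp only [ext, extend_val _ hw]; rfl

theorem ext_smul (c : ℂ) : (c • s).ext w = c * s.ext w := by
  simp only [ext, extend_val _ hw]; rfl

theorem ext_zero : (0 : SmoothFun W).ext w = 0 := by
  simp only [ext, extend_val _ hw]; rfl

theorem ext_one : (1 : SmoothFun W).ext w = 1 := by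
  simp only [ext, extend_val _ hw]; rfl

end

/-- The derivative in the direction `v`. -/
def pd (hW : UniqueDiffOn ℝ W) (v : E) : Derivation ℂ (SmoothFun W) (SmoothFun W) :=
  have hd : ∀ (s : SmoothFun W) {w : E}, w ∈ W → DifferentiableWithinAt ℝ s.ext W w :=
    fun s _ hw => s.contDiffOn_ext.differentiableOn (by simp) _ hw
  Derivation.mk'
    { toFun := fun s => ofFun (fun x => fderivWithin ℝ s.ext W x v)
        ((s.contDiffOn_ext.fderivWithin hW (by simp)).clm_apply contDiffOn_const)
      map_add' := fun s s' => eq_of_ext fun w hw => by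
        rw [ext_add hw, ext_ofFun _ _ hw, ext_ofFun _ _ hw, ext_ofFun _ _ hw,
          fderivWithin_congr (f := s.ext + s'.ext) (fun x hx => ext_add hx s s') (ext_add hw s s'),
          fderivWithin_add (hW w hw) (hd s hw) (hd s' hw)]
        rfl
      map_smul' := fun c s => eq_of_ext fun w hw => by
        rw [RingHom.id_apply, ext_smul hw, ext_ofFun _ _ hw, ext_ofFun _ _ hw,
          fderivWithin_congr (f := c • s.ext) (fun x hx => ext_smul hx s c) (ext_smul hw s c),
          fderivWithin_const_smul (hW w hw)]
        · rfl
        · exact hd s hw }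
    fun s s' => eq_of_ext fun w hw => by
      simp only [LinearMap.coe_mk, AddHom.coe_mk, smul_eq_mul]
      rw [ext_add hw, ext_mul hw, ext_mul hw, ext_ofFun _ _ hw, ext_ofFun _ _ hw, ext_ofFun _ _ hw,
        fderivWithin_congr (f := s.ext * s'.ext) (fun x hx => ext_mul hx s s') (ext_mul hw s s'),
        fderivWithin_mul (hW w hw) (hd s hw) (hd s' hw)]
      rfl

theorem ext_pd (hW : UniqueDiffOn ℝ W) (v : E) (s : SmoothFun W) {w : E} (hw : w ∈ W) :
    (pd hW v s).ext w = fderivWithin ℝ s.ext W w v := ext_ofFun _ _ hw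

/-- Symmetry of second derivatives within W extends to points in the closure of the interior. For
space-time this includes the boundary t = 0, where time derivatives are one-sided. -/
theorem pd_comm (hW : UniqueDiffOn ℝ W) (hc : W ⊆ closure (interior W)) (u v : E)
    (s : SmoothFun W) : pd hW u (pd hW v s) = pd hW v (pd hW u s) := by
  have key : ∀ u v : E, ∀ w ∈ W, (pd hW u (pd hW v s)).ext w
      = fderivWithin ℝ (fderivWithin ℝ s.ext W) W w u v := by
    intro u v w hw
    have hd : DifferentiableWithinAt ℝ (fderivWithin ℝ s.ext W) W w :=
      (s.contDiffOn_ext.fderivWithin (m := ∞) hW (by simp)).differentiableOn (by simp) w hw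
    rw [ext_pd _ _ _ hw, fderivWithin_congr (f := fun x => fderivWithin ℝ s.ext W x v)
        (fun x hx => ext_pd hW v s hx) (ext_pd hW v s hw),
      fderivWithin_clm_apply (hW w hw) hd (differentiableWithinAt_const v)]
    simp [fderivWithin_const_apply]
  refine eq_of_ext fun w hw => ?_
  rw [key _ _ _ hw, key _ _ _ hw]
  have hs : ContDiffWithinAt ℝ 2 s.ext W w :=
    (s.contDiffOn_ext w hw).of_le (by norm_cast)
  exact hs.isSymmSndFDerivWithinAt (by simp) hW (hc hw) hw u v

end SmoothFun

end SmoothFun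

/-! ## Smooth functions of time and space -/

section Flow

variable {τ : ℝ} {U : Set C3}

/-- Space-time. -/
abbrev dom (τ : ℝ) (U : Set C3) : Set (ℝ × C3) := Set.Ico 0 τ ×ˢ U

theorem uniqueDiffOn_dom (τ : ℝ) (hU : IsOpen U) : UniqueDiffOn ℝ (dom τ U) :=
  (uniqueDiffOn_Ico 0 τ).prod hU.uniqueDiffOn

theorem dom_subset_closure_interior (hU : IsOpen U) :
    dom τ U ⊆ closure (interior (dom τ U)) := by
  rintro ⟨t, z⟩ ⟨ht, hz⟩
  have hτ : (0 : ℝ) ≠ τ := (ht.1.trans_lt ht.2).ne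
  rw [interior_prod_eq, interior_Ico, hU.interior_eq, closure_prod_eq, closure_Ioo hτ]
  exact ⟨Set.Ico_subset_Icc_self ht, subset_closure hz⟩

open SmoothFun

/-- The Wirtinger derivatives as derivations. -/
def wirtD (τ : ℝ) (hU : IsOpen U) :
    Idx → Derivation ℂ (SmoothFun (dom τ U)) (SmoothFun (dom τ U))
  | Sum.inl j => (1 / 2 : ℂ) • (pd (uniqueDiffOn_dom τ hU) (0, Pi.single j 1)
      - Complex.I • pd (uniqueDiffOn_dom τ hU) (0, Pi.single j Complex.I))
  | Sum.inr j => (1 / 2 : ℂ) • (pd (uniqueDiffOn_dom τ hU) (0, Pi.single j 1)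
      + Complex.I • pd (uniqueDiffOn_dom τ hU) (0, Pi.single j Complex.I))

/-- The time derivative. -/
def timeD (τ : ℝ) (hU : IsOpen U) :
    Derivation ℂ (SmoothFun (dom τ U)) (SmoothFun (dom τ U)) :=
  pd (uniqueDiffOn_dom τ hU) (1, 0)

theorem timeD_comm (hU : IsOpen U) (a : Idx) (s : SmoothFun (dom τ U)) :
    timeD τ hU (wirtD τ hU a s) = wirtD τ hU a (timeD τ hU s) := by
  have h := pd_comm (uniqueDiffOn_dom τ hU) (dom_subset_closure_interior hU)
  rcases a with j | j <;>
  simp only [wirtD, timeD, Derivation.smul_apply, Derivation.sub_apply, Derivation.add_apply] <;>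
  simp only [Derivation.map_smul, map_sub, map_add, h (1, 0)]

theorem wirtD_comm (hU : IsOpen U) (a b : Idx) (s : SmoothFun (dom τ U)) :
    wirtD τ hU a (wirtD τ hU b s) = wirtD τ hU b (wirtD τ hU a s) := by
  have h := pd_comm (uniqueDiffOn_dom τ hU) (dom_subset_closure_interior hU)
  -- As a rewrite rule this always moves the imaginary direction outwards. The real-real and
  -- imaginary-imaginary rules are given only for one fixed order of j and k, so that rewriting
  -- terminates.
  have h1 := fun i j : Fin 3 => h (0, Pi.single i 1) (0, Pi.single j Complex.I) s
  rcases a with j | j <;> rcases b with k | k <;>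
  simp only [wirtD, Derivation.smul_apply, Derivation.sub_apply, Derivation.add_apply,
    Derivation.map_smul, map_sub, map_add, h1, 
    h (0, Pi.single j 1) (0, Pi.single k 1) s,
    h (0, Pi.single j Complex.I) (0, Pi.single k Complex.I) s] <;>
  module

/-! ### Representatives of time-dependent functions -/

/-- The family of functions `F t` is represented on space-time by `s`. -/
def Rep (F : ℝ → C3 → ℂ) (s : SmoothFun (dom τ U)) : Prop :=
  ∀ t ∈ Set.Ico 0 τ, ∀ z ∈ U, F t z = s.ext (t, z)

namespace Rep

variable {F F' : ℝ → C3 → ℂ} {s s' : SmoothFun (dom τ U)}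

theorem congr (h : Rep F s) (e : ∀ t ∈ Set.Ico 0 τ, ∀ z ∈ U, F' t z = F t z) : Rep F' s :=
  fun t ht z hz => (e t ht z hz).trans (h t ht z hz)

/-- This is how pointwise equations become equations in the ring. -/
theorem unique (h : Rep F s) (h' : Rep F s') : s = s' :=
  eq_of_ext fun w hw => by
    rw [← Prod.mk.eta (p := w), ← h _ hw.1 _ hw.2, ← h' _ hw.1 _ hw.2]

theorem add (h : Rep F s) (h' : Rep F' s') : Rep (fun t z => F t z + F' t z) (s + s') :=
  fun t ht z hz => by simp only [ext_add (W := dom τ U) (w := (t, z)) ⟨ht, hz⟩, h t ht z hz, h' t ht z hz]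

theorem sub (h : Rep F s) (h' : Rep F' s') : Rep (fun t z => F t z - F' t z) (s - s') :=
  fun t ht z hz => by simp only [ext_sub (W := dom τ U) (w := (t, z)) ⟨ht, hz⟩, h t ht z hz, h' t ht z hz]

theorem mul (h : Rep F s) (h' : Rep F' s') : Rep (fun t z => F t z * F' t z) (s * s') :=
  fun t ht z hz => by simp only [ext_mul (W := dom τ U) (w := (t, z)) ⟨ht, hz⟩, h t ht z hz, h' t ht z hz]

theorem neg (h : Rep F s) : Rep (fun t z => -F t z) (-s) :=
  fun t ht z hz => by simp only [ext_neg (W := dom τ U) (w := (t, z)) ⟨ht, hz⟩, h t ht z hz]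

theorem smul (c : ℂ) (h : Rep F s) : Rep (fun t z => c * F t z) (c • s) :=
  fun t ht z hz => by simp only [ext_smul (W := dom τ U) (w := (t, z)) ⟨ht, hz⟩, h t ht z hz]

theorem zero : Rep (fun _ _ => 0) (0 : SmoothFun (dom τ U)) :=
  fun t ht z hz => by rw [ext_zero (W := dom τ U) ⟨ht, hz⟩]

theorem one : Rep (fun _ _ => 1) (1 : SmoothFun (dom τ U)) :=
  fun t ht z hz => by rw [ext_one (W := dom τ U) ⟨ht, hz⟩]

theorem sum {ι : Type*} {I : Finset ι} {F : ι → ℝ → C3 → ℂ} {s : ι → SmoothFun (dom τ U)}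
    (h : ∀ i, Rep (F i) (s i)) : Rep (fun t z => ∑ i ∈ I, F i t z) (∑ i ∈ I, s i) := by
  classical
  induction I using Finset.induction_on with
  | empty => simpa using zero
  | insert i I hi ih => simpa only [Finset.sum_insert hi] using (h i).add ih

theorem of_contDiffOn (F : ℝ → C3 → ℂ)
    (hF : ContDiffOn ℝ ∞ (fun y : ℝ × C3 => F y.1 y.2) (dom τ U)) :
    Rep F (ofFun (fun y : ℝ × C3 => F y.1 y.2) hF) :=
  fun t ht z hz =>
    (ext_ofFun (W := dom τ U) (fun y : ℝ × C3 => F y.1 y.2) hF (w := (t, z)) ⟨ht, hz⟩).symm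

theorem contDiffOn (h : Rep F s) : ContDiffOn ℝ ∞ (fun y : ℝ × C3 => F y.1 y.2) (dom τ U) :=
  s.contDiffOn_ext.congr fun y hy => h y.1 hy.1 y.2 hy.2

theorem contDiffOn_slice (h : Rep F s) {t : ℝ} (ht : t ∈ Set.Ico 0 τ) :
    ContDiffOn ℝ ∞ (F t) U := by
  have : ContDiffOn ℝ ∞ (fun z => s.ext (t, z)) U :=
    s.contDiffOn_ext.comp (contDiff_const.prodMk contDiff_id).contDiffOn fun z hz => ⟨ht, hz⟩
  exact this.congr fun z hz => h t ht z hz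

theorem fderiv_eq (hU : IsOpen U) (h : Rep F s) {t : ℝ} (ht : t ∈ Set.Ico 0 τ) {z : C3}
    (hz : z ∈ U) (v : C3) :
    fderiv ℝ (F t) z v = (pd (uniqueDiffOn_dom τ hU) (0, v) s).ext (t, z) := by
  have hw : (t, z) ∈ dom τ U := ⟨ht, hz⟩
  have h1 : HasFDerivWithinAt s.ext (fderivWithin ℝ s.ext (dom τ U) (t, z)) (dom τ U) (t, z) :=
    (s.contDiffOn_ext.differentiableOn (by simp) _ hw).hasFDerivWithinAt
  have h2 : HasFDerivWithinAt (fun z => s.ext (t, z)) _ U z :=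
    h1.comp z (hasFDerivAt_prodMk_right t z).hasFDerivWithinAt fun z hz => ⟨ht, hz⟩
  have h3 : F t =ᶠ[nhds z] fun z => s.ext (t, z) :=
    Filter.eventuallyEq_of_mem (hU.mem_nhds hz) fun z hz => h t ht z hz
  rw [h3.fderiv_eq, (h2.hasFDerivAt (hU.mem_nhds hz)).fderiv, ext_pd _ _ _ hw]
  rfl

theorem wirt (hU : IsOpen U) (h : Rep F s) (a : Idx) :
    Rep (fun t => wirt a (F t)) (wirtD τ hU a s) := by
  intro t ht z hz
  have hw : (t, z) ∈ dom τ U := ⟨ht, hz⟩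
  rcases a with j | j
  · simp only [AnomalyFlow.wirt, wirtD, Derivation.smul_apply, Derivation.sub_apply, ext_smul hw,
      ext_sub hw, h.fderiv_eq hU ht hz]
    ring
  · simp only [AnomalyFlow.wirt, wirtD, Derivation.smul_apply, Derivation.add_apply, ext_smul hw,
      ext_add hw, h.fderiv_eq hU ht hz]
    ring

theorem hasDerivWithinAt (hU : IsOpen U) (h : Rep F s) {t : ℝ} (ht : t ∈ Set.Ico 0 τ) {z : C3}
    (hz : z ∈ U) :
    HasDerivWithinAt (fun t => F t z) ((timeD τ hU s).ext (t, z)) (Set.Ico 0 τ) t := by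
  have hw : (t, z) ∈ dom τ U := ⟨ht, hz⟩
  have h1 : HasFDerivWithinAt s.ext (fderivWithin ℝ s.ext (dom τ U) (t, z)) (dom τ U) (t, z) :=
    (s.contDiffOn_ext.differentiableOn (by simp) _ hw).hasFDerivWithinAt
  have hm : Set.MapsTo (fun t : ℝ => (t, z)) (Set.Ico 0 τ) (dom τ U) := fun t ht => ⟨ht, hz⟩
  have h2 := h1.comp_hasDerivWithinAt t
    ((hasDerivWithinAt_id t _).prodMk (hasDerivWithinAt_const t _ z)) hm
  rw [timeD, ext_pd _ _ _ hw]
  exact h2.congr (fun t ht => h t ht z hz) (h t ht z hz)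

/-- A function whose time derivative is known pointwise. -/
theorem timeD_of_hasDerivWithinAt (hU : IsOpen U) (h : Rep F s)
    (hd : ∀ t ∈ Set.Ico 0 τ, ∀ z ∈ U,
      HasDerivWithinAt (fun t => F t z) (F' t z) (Set.Ico 0 τ) t) :
    Rep F' (timeD τ hU s) :=
  fun t ht z hz => (uniqueDiffOn_Ico 0 τ t ht).eq_deriv _ (hd t ht z hz)
    (h.hasDerivWithinAt hU ht hz)

/-- A function with vanishing time derivative and initial value vanishes. -/
theorem eq_zero_of_timeD (hU : IsOpen U) (h : Rep F s) (h0 : ∀ z ∈ U, F 0 z = 0)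
    (hd : timeD τ hU s = 0) : s = 0 := by
  refine eq_of_ext fun ⟨t, z⟩ hw => ?_
  have hz : z ∈ U := hw.2
  have ht : t ∈ Set.Ico 0 τ := hw.1
  have hd' : ∀ x ∈ Set.Ico 0 τ, HasDerivWithinAt (fun t => F t z) 0 (Set.Ico 0 τ) x :=
    fun x hx => by
      have := h.hasDerivWithinAt hU hx hz
      rwa [hd, ext_zero (W := dom τ U) ⟨hx, hz⟩] at this
  have hc : F t z = F 0 z := by
    refine (convex_Ico 0 τ).is_const_of_fderivWithin_eq_zero (𝕜 := ℝ)
      (f := fun t => F t z) (fun x hx => (hd' x hx).differentiableWithinAt) (fun x hx => ?_) ht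
      ⟨le_rfl, ht.1.trans_lt ht.2⟩
    have := ((hd' x hx).hasFDerivWithinAt.fderivWithin (uniqueDiffOn_Ico 0 τ x hx))
    rw [this]; ext; simp
  rw [ext_zero hw, ← h t ht z hz, hc, h0 z hz]

/-- A nowhere vanishing smooth function is invertible. -/
theorem exists_inv (h : Rep F s) (hF : ∀ t ∈ Set.Ico 0 τ, ∀ z ∈ U, F t z ≠ 0) :
    ∃ s' : SmoothFun (dom τ U), Rep (fun t z => (F t z)⁻¹) s' ∧ s * s' = 1 := by
  have hc : ContDiffOn ℝ ∞ (fun y : ℝ × C3 => (F y.1 y.2)⁻¹) (dom τ U) :=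
    h.contDiffOn.inv fun y hy => hF y.1 hy.1 y.2 hy.2
  refine ⟨_, of_contDiffOn (fun t z => (F t z)⁻¹) hc, eq_of_ext fun ⟨t, z⟩ hw => ?_⟩
  rw [ext_mul hw, ext_one hw, ext_ofFun _ _ hw, ← h t hw.1 z hw.2]
  exact mul_inv_cancel₀ (hF t hw.1 z hw.2)

theorem exists_sqrt (h : Rep F s) (hF : ∀ t ∈ Set.Ico 0 τ, ∀ z ∈ U, 0 < (F t z).re) :
    ∃ s' : SmoothFun (dom τ U), Rep (fun t z => (Real.sqrt (F t z).re : ℂ)) s' := by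
  have hre : ContDiffOn ℝ ∞ (fun y : ℝ × C3 => (F y.1 y.2).re) (dom τ U) :=
    Complex.reCLM.contDiff.comp_contDiffOn h.contDiffOn
  have hc : ContDiffOn ℝ ∞ (fun y : ℝ × C3 => (Real.sqrt (F y.1 y.2).re : ℂ)) (dom τ U) :=
    Complex.ofRealCLM.contDiff.comp_contDiffOn
      (hre.sqrt fun y hy => (hF y.1 hy.1 y.2 hy.2).ne')
  exact ⟨_, of_contDiffOn (fun t z => (Real.sqrt (F t z).re : ℂ)) hc⟩

end Rep

end Flow

/-! ## Wedge products -/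

/-- The (2, 2)-shuffles. -/
def shuffle22 : Fin 6 → Equiv.Perm (Fin (2 + 2)) :=
  ![⟨![0, 1, 2, 3], ![0, 1, 2, 3], by decide, by decide⟩,
    ⟨![0, 2, 1, 3], ![0, 2, 1, 3], by decide, by decide⟩,
    ⟨![0, 3, 1, 2], ![0, 2, 3, 1], by decide, by decide⟩,
    ⟨![1, 2, 0, 3], ![2, 0, 1, 3], by decide, by decide⟩,
    ⟨![1, 3, 0, 2], ![2, 0, 3, 1], by decide, by decide⟩,
    ⟨![2, 3, 0, 1], ![2, 3, 0, 1], by decide, by decide⟩]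

/-- The signs of the (2, 2)-shuffles. -/
def shuffleSign22 : Fin 6 → ℤ :=
  ![1, -1, 1, 1, -1, 1]

/-- An exhaustive check over the 24 permutations; it makes the wedge product of two 2-forms an
explicit six-term expression. -/
theorem sum_shuffle22 (f : Equiv.Perm (Fin (2 + 2)) → ℂ) :
    ∑ σ : Equiv.Perm (Fin (2 + 2)) with
      (∀ i j : Fin 2, i < j → σ (Fin.castAdd 2 i) < σ (Fin.castAdd 2 j)) ∧
      (∀ i j : Fin 2, i < j → σ (Fin.natAdd 2 i) < σ (Fin.natAdd 2 j)),
      f σ = ∑ n, f (shuffle22 n) := by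
  have h : (Finset.univ.filter fun σ : Equiv.Perm (Fin (2 + 2)) =>
      (∀ i j : Fin 2, i < j → σ (Fin.castAdd 2 i) < σ (Fin.castAdd 2 j)) ∧
      (∀ i j : Fin 2, i < j → σ (Fin.natAdd 2 i) < σ (Fin.natAdd 2 j)))
      = Finset.univ.image shuffle22 := by decide +kernel
  have hi : Function.Injective shuffle22 := by
    unfold Function.Injective; decide +kernel
  rw [h, Finset.sum_image fun _ _ _ _ e => hi e]

theorem sign_shuffle22 (n : Fin 6) :
    ((Equiv.Perm.sign (shuffle22 n) : ℤˣ) : ℤ) = shuffleSign22 n := by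
  revert n; decide +kernel

/-- The wedge product of a 2-form and a 2-form. -/
theorem wedge22 (φ : Coeffs 2) (ψ : Coeffs 2) (a : Fin (2 + 2) → Idx) (z : C3) :
    wedge φ ψ a z =
      φ ![a 0, a 1] z * ψ ![a 2, a 3] z
      - φ ![a 0, a 2] z * ψ ![a 1, a 3] z
      + φ ![a 0, a 3] z * ψ ![a 1, a 2] z
      + φ ![a 1, a 2] z * ψ ![a 0, a 3] z
      - φ ![a 1, a 3] z * ψ ![a 0, a 2] z
      + φ ![a 2, a 3] z * ψ ![a 0, a 1] z := by
  have e : ∀ n, ((Equiv.Perm.sign (shuffle22 n) : ℤ) : ℂ) = (shuffleSign22 n : ℂ) :=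
    fun n => congrArg _ (sign_shuffle22 n)
  have hl : ∀ n, (fun i : Fin 2 => a (shuffle22 n (Fin.castAdd 2 i)))
      = ![a (shuffle22 n 0), a (shuffle22 n 1)] := fun n => by
    funext i; fin_cases i <;> rfl
  have hr : ∀ n, (fun i : Fin 2 => a (shuffle22 n (Fin.natAdd 2 i)))
      = ![a (shuffle22 n 2), a (shuffle22 n 3)] := fun n => by
    funext i; fin_cases i <;> rfl
  rw [wedge, sum_shuffle22]
  simp only [hl, hr, e, Fin.sum_univ_succ, Fin.sum_univ_zero]
  simp [shuffle22, shuffleSign22]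
  ring

/-- The (4, 2)-shuffles. -/
def shuffle42 : Fin 15 → Equiv.Perm (Fin (4 + 2)) :=
  ![⟨![0, 1, 2, 3, 4, 5], ![0, 1, 2, 3, 4, 5], by decide, by decide⟩,
    ⟨![0, 1, 2, 4, 3, 5], ![0, 1, 2, 4, 3, 5], by decide, by decide⟩,
    ⟨![0, 1, 2, 5, 3, 4], ![0, 1, 2, 4, 5, 3], by decide, by decide⟩,
    ⟨![0, 1, 3, 4, 2, 5], ![0, 1, 4, 2, 3, 5], by decide, by decide⟩,
    ⟨![0, 1, 3, 5, 2, 4], ![0, 1, 4, 2, 5, 3], by decide, by decide⟩,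
    ⟨![0, 1, 4, 5, 2, 3], ![0, 1, 4, 5, 2, 3], by decide, by decide⟩,
    ⟨![0, 2, 3, 4, 1, 5], ![0, 4, 1, 2, 3, 5], by decide, by decide⟩,
    ⟨![0, 2, 3, 5, 1, 4], ![0, 4, 1, 2, 5, 3], by decide, by decide⟩,
    ⟨![0, 2, 4, 5, 1, 3], ![0, 4, 1, 5, 2, 3], by decide, by decide⟩,
    ⟨![0, 3, 4, 5, 1, 2], ![0, 4, 5, 1, 2, 3], by decide, by decide⟩,
    ⟨![1, 2, 3, 4, 0, 5], ![4, 0, 1, 2, 3, 5], by decide, by decide⟩,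
    ⟨![1, 2, 3, 5, 0, 4], ![4, 0, 1, 2, 5, 3], by decide, by decide⟩,
    ⟨![1, 2, 4, 5, 0, 3], ![4, 0, 1, 5, 2, 3], by decide, by decide⟩,
    ⟨![1, 3, 4, 5, 0, 2], ![4, 0, 5, 1, 2, 3], by decide, by decide⟩,
    ⟨![2, 3, 4, 5, 0, 1], ![4, 5, 0, 1, 2, 3], by decide, by decide⟩]

/-- The signs of the (4, 2)-shuffles. -/
def shuffleSign42 : Fin 15 → ℤ :=
  ![1, -1, 1, 1, -1, 1, -1, 1, -1, 1, 1, -1, 1, -1, 1]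

theorem sum_shuffle42 (f : Equiv.Perm (Fin (4 + 2)) → ℂ) :
    ∑ σ : Equiv.Perm (Fin (4 + 2)) with
      (∀ i j : Fin 4, i < j → σ (Fin.castAdd 2 i) < σ (Fin.castAdd 2 j)) ∧
      (∀ i j : Fin 2, i < j → σ (Fin.natAdd 4 i) < σ (Fin.natAdd 4 j)),
      f σ = ∑ n, f (shuffle42 n) := by
  have h : (Finset.univ.filter fun σ : Equiv.Perm (Fin (4 + 2)) =>
      (∀ i j : Fin 4, i < j → σ (Fin.castAdd 2 i) < σ (Fin.castAdd 2 j)) ∧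
      (∀ i j : Fin 2, i < j → σ (Fin.natAdd 4 i) < σ (Fin.natAdd 4 j)))
      = Finset.univ.image shuffle42 := by decide +kernel
  have hi : Function.Injective shuffle42 := by
    unfold Function.Injective; decide +kernel
  rw [h, Finset.sum_image fun _ _ _ _ e => hi e]

theorem sign_shuffle42 (n : Fin 15) :
    ((Equiv.Perm.sign (shuffle42 n) : ℤˣ) : ℤ) = shuffleSign42 n := by
  revert n; decide +kernel

/-- The wedge product of a 4-form and a 2-form. -/
theorem wedge42 (φ : Coeffs 4) (ψ : Coeffs 2) (a : Fin (4 + 2) → Idx) (z : C3) :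
    wedge φ ψ a z =
      φ ![a 0, a 1, a 2, a 3] z * ψ ![a 4, a 5] z
      - φ ![a 0, a 1, a 2, a 4] z * ψ ![a 3, a 5] z
      + φ ![a 0, a 1, a 2, a 5] z * ψ ![a 3, a 4] z
      + φ ![a 0, a 1, a 3, a 4] z * ψ ![a 2, a 5] z
      - φ ![a 0, a 1, a 3, a 5] z * ψ ![a 2, a 4] z
      + φ ![a 0, a 1, a 4, a 5] z * ψ ![a 2, a 3] z
      - φ ![a 0, a 2, a 3, a 4] z * ψ ![a 1, a 5] z
      + φ ![a 0, a 2, a 3, a 5] z * ψ ![a 1, a 4] z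
      - φ ![a 0, a 2, a 4, a 5] z * ψ ![a 1, a 3] z
      + φ ![a 0, a 3, a 4, a 5] z * ψ ![a 1, a 2] z
      + φ ![a 1, a 2, a 3, a 4] z * ψ ![a 0, a 5] z
      - φ ![a 1, a 2, a 3, a 5] z * ψ ![a 0, a 4] z
      + φ ![a 1, a 2, a 4, a 5] z * ψ ![a 0, a 3] z
      - φ ![a 1, a 3, a 4, a 5] z * ψ ![a 0, a 2] z
      + φ ![a 2, a 3, a 4, a 5] z * ψ ![a 0, a 1] z := by
  have e : ∀ n, ((Equiv.Perm.sign (shuffle42 n) : ℤ) : ℂ) = (shuffleSign42 n : ℂ) :=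
    fun n => congrArg _ (sign_shuffle42 n)
  have hl : ∀ n, (fun i : Fin 4 => a (shuffle42 n (Fin.castAdd 2 i)))
      = ![a (shuffle42 n 0), a (shuffle42 n 1), a (shuffle42 n 2), a (shuffle42 n 3)] := fun n => by
    funext i; fin_cases i <;> rfl
  have hr : ∀ n, (fun i : Fin 2 => a (shuffle42 n (Fin.natAdd 4 i)))
      = ![a (shuffle42 n 4), a (shuffle42 n 5)] := fun n => by
    funext i; fin_cases i <;> rfl
  rw [wedge, sum_shuffle42]
  simp only [hl, hr, e, Fin.sum_univ_succ, Fin.sum_univ_zero]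
  simp [shuffle42, shuffleSign42]
  ring

/-! ## Components of the forms -/

section Components

variable (G : MatFun) (z : C3)

theorem kahler_lr (j k : Fin 3) :
    kahler G ![Sum.inl j, Sum.inr k] = fun z => Complex.I * G z k j := rfl

theorem kahler_rl (j k : Fin 3) :
    kahler G ![Sum.inr k, Sum.inl j] = fun z => -(Complex.I * G z k j) := rfl

theorem kahler_ll (j k : Fin 3) : kahler G ![Sum.inl j, Sum.inl k] = fun _ => 0 := rfl

theorem kahler_rr (j k : Fin 3) : kahler G ![Sum.inr j, Sum.inr k] = fun _ => 0 := rfl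

theorem wedge_kahler_llrr (q s p r : Fin 3) :
    wedge (kahler G) (kahler G) ![Sum.inl q, Sum.inl s, Sum.inr p, Sum.inr r] z
      = 2 * (G z p q * G z r s - G z r q * G z p s) := by
  rw [wedge22]
  simp only [Matrix.cons_val, kahler_lr, kahler_rr, kahler_ll]
  linear_combination (2 * (G z r q * G z p s - G z p q * G z r s)) * Complex.I_mul_I

/-- The frame order q, r̄, s, p̄ is the one in `comp22`, while q, s, p̄, r̄ is convenient for d.
They differ by a cyclic permutation of the last three slots, which is even, so the values agree. -/
theorem wedge_kahler_lrlr (q s p r : Fin 3) :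
    wedge (kahler G) (kahler G) ![Sum.inl q, Sum.inr r, Sum.inl s, Sum.inr p] z
      = 2 * (G z p q * G z r s - G z r q * G z p s) := by
  rw [wedge22]
  simp only [Matrix.cons_val, kahler_lr, kahler_rl, kahler_rr, kahler_ll]
  linear_combination (2 * (G z r q * G z p s - G z p q * G z r s)) * Complex.I_mul_I

theorem wedge_kahler_lllr (q s p r : Fin 3) :
    wedge (kahler G) (kahler G) ![Sum.inl q, Sum.inl s, Sum.inl p, Sum.inr r] z = 0 := by
  rw [wedge22]
  simp [kahler_ll]

theorem wedge_kahler_lrrr (q s p r : Fin 3) :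
    wedge (kahler G) (kahler G) ![Sum.inl q, Sum.inr s, Sum.inr p, Sum.inr r] z = 0 := by
  rw [wedge22]
  simp [kahler_rr]

/-- The frame `∂_1, ∂_2, ∂_3, ∂_1̄, ∂_2̄, ∂_3̄`. -/
abbrev topFrame : Fin 6 → Idx :=
  ![Sum.inl 0, Sum.inl 1, Sum.inl 2, Sum.inr 0, Sum.inr 1, Sum.inr 2]

/-- The factor `Complex.I` cancels the one in iΩ ∧ Ω̄, so that ‖Ω‖² = |f|² / (6 det g). -/
theorem wedge_kahler_top :
    wedge (wedge (kahler G) (kahler G)) (kahler G) topFrame z = Complex.I * (6 * (G z).det) := by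
  have h := wedge42 (wedge (kahler G) (kahler G)) (kahler G) topFrame z
  simp only [Matrix.cons_val, kahler_ll, kahler_rr, kahler_lr, wedge_kahler_llrr] at h
  rw [Matrix.det_fin_three]
  refine h.trans ?_
  ring

theorem curvForm_lr (p q j k : Fin 3) :
    curvForm G p q ![Sum.inl j, Sum.inr k] = curv G k j p q := rfl

theorem curvForm_rl (p q j k : Fin 3) :
    curvForm G p q ![Sum.inr k, Sum.inl j] = fun z => -curv G k j p q z := rfl

theorem curvForm_ll (p q j k : Fin 3) :
    curvForm G p q ![Sum.inl j, Sum.inl k] = fun _ => 0 := rfl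

theorem curvForm_rr (p q j k : Fin 3) :
    curvForm G p q ![Sum.inr j, Sum.inr k] = fun _ => 0 := rfl

theorem trRmRm_lrlr (q s p r : Fin 3) :
    trRmRm G ![Sum.inl q, Sum.inr r, Sum.inl s, Sum.inr p] z = RR G p s r q z := by
  simp only [trRmRm, RR]
  refine Finset.sum_congr rfl fun α _ => Finset.sum_congr rfl fun β _ => ?_
  rw [wedge22]
  simp only [Matrix.cons_val, curvForm_lr, curvForm_rl, curvForm_ll, curvForm_rr]
  ring

theorem trRmRm_llrr (q s p r : Fin 3) :
    trRmRm G ![Sum.inl q, Sum.inl s, Sum.inr p, Sum.inr r] z = RR G p s r q z := by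
  simp only [trRmRm, RR]
  refine Finset.sum_congr rfl fun α _ => Finset.sum_congr rfl fun β _ => ?_
  rw [wedge22]
  simp only [Matrix.cons_val, curvForm_lr, curvForm_ll, curvForm_rr]
  ring

theorem torsion_llr (m j k : Fin 3) :
    torsion G ![Sum.inl m, Sum.inl j, Sum.inr k] z
      = Complex.I * (wirt (Sum.inl m) (fun w => Complex.I * G w k j) z
        - wirt (Sum.inl j) (fun w => Complex.I * G w k m) z) := by
  have e : torsion G ![Sum.inl m, Sum.inl j, Sum.inr k] z
      = Complex.I * (wirt (Sum.inl m) (kahler G ![Sum.inl j, Sum.inr k]) z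
        - wirt (Sum.inl j) (kahler G ![Sum.inl m, Sum.inr k]) z) := by
    simp [torsion, del, Fin.sum_univ_three, ← sub_eq_add_neg]
    rfl
  exact e

theorem torsionBar_rrl (m j k : Fin 3) :
    torsionBar G ![Sum.inr m, Sum.inr j, Sum.inl k] z
      = -(Complex.I * (wirt (Sum.inr m) (fun w => -(Complex.I * G w j k)) z
        - wirt (Sum.inr j) (fun w => -(Complex.I * G w m k)) z)) := by
  have e : torsionBar G ![Sum.inr m, Sum.inr j, Sum.inl k] z
      = -(Complex.I * (wirt (Sum.inr m) (kahler G ![Sum.inr j, Sum.inl k]) z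
        - wirt (Sum.inr j) (kahler G ![Sum.inr m, Sum.inl k]) z)) := by
    simp [torsionBar, delbar, Fin.sum_univ_three, ← sub_eq_add_neg]
    rfl
  exact e

theorem delbar_kahler_lrr (s p r : Fin 3) :
    delbar (kahler G) ![Sum.inl s, Sum.inr p, Sum.inr r] = fun z =>
      -wirt (Sum.inr p) (fun w => Complex.I * G w r s) z
        + wirt (Sum.inr r) (fun w => Complex.I * G w p s) z := by
  funext z
  simp [delbar, Fin.sum_univ_three]
  rfl

theorem delbar_kahler_rlr (s p r : Fin 3) :
    delbar (kahler G) ![Sum.inr r, Sum.inl s, Sum.inr p] = fun z =>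
      wirt (Sum.inr r) (fun w => Complex.I * G w p s) z
        + wirt (Sum.inr p) (fun w => -(Complex.I * G w r s)) z := by
  funext z
  simp [delbar, Fin.sum_univ_three]
  rfl

theorem del_delbar_llrr (q s p r : Fin 3) :
    del (delbar (kahler G)) ![Sum.inl q, Sum.inl s, Sum.inr p, Sum.inr r] z =
      wirt (Sum.inl q) (fun z => -wirt (Sum.inr p) (fun w => Complex.I * G w r s) z
        + wirt (Sum.inr r) (fun w => Complex.I * G w p s) z) z
      - wirt (Sum.inl s) (fun z => -wirt (Sum.inr p) (fun w => Complex.I * G w r q) z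
        + wirt (Sum.inr r) (fun w => Complex.I * G w p q) z) z := by
  rw [← delbar_kahler_lrr, ← delbar_kahler_lrr]
  simp [del, Fin.sum_univ_four, ← sub_eq_add_neg]
  rfl

theorem del_delbar_lrlr (q s p r : Fin 3) :
    del (delbar (kahler G)) ![Sum.inl q, Sum.inr r, Sum.inl s, Sum.inr p] z =
      wirt (Sum.inl q) (fun z => wirt (Sum.inr r) (fun w => Complex.I * G w p s) z
        + wirt (Sum.inr p) (fun w => -(Complex.I * G w r s)) z) z
      + wirt (Sum.inl s) (fun z => -wirt (Sum.inr r) (fun w => Complex.I * G w p q) z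
        + wirt (Sum.inr p) (fun w => Complex.I * G w r q) z) z := by
  rw [← delbar_kahler_rlr, ← delbar_kahler_lrr]
  simp [del, Fin.sum_univ_four]
  rfl

theorem extD_lllrr (φ : Coeffs 4) (m q s p r : Fin 3) :
    extD φ ![Sum.inl m, Sum.inl q, Sum.inl s, Sum.inr p, Sum.inr r] z =
      wirt (Sum.inl m) (φ ![Sum.inl q, Sum.inl s, Sum.inr p, Sum.inr r]) z
      - wirt (Sum.inl q) (φ ![Sum.inl m, Sum.inl s, Sum.inr p, Sum.inr r]) z
      + wirt (Sum.inl s) (φ ![Sum.inl m, Sum.inl q, Sum.inr p, Sum.inr r]) z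
      - wirt (Sum.inr p) (φ ![Sum.inl m, Sum.inl q, Sum.inl s, Sum.inr r]) z
      + wirt (Sum.inr r) (φ ![Sum.inl m, Sum.inl q, Sum.inl s, Sum.inr p]) z := by
  have e : ∀ (i : Fin 5) (v : Fin 4 → Idx) (a : Fin 5 → Idx), (∀ m, a (i.succAbove m) = v m) →
      φ (fun m => a (i.succAbove m)) = φ v := fun i v a h => congrArg φ (funext h)
  simp only [extD, del, delbar, Nat.reduceAdd, Fin.sum_univ_five]
  rw [e 0 ![Sum.inl q, Sum.inl s, Sum.inr p, Sum.inr r] _ fun m => by fin_cases m <;> rfl,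
    e 1 ![Sum.inl m, Sum.inl s, Sum.inr p, Sum.inr r] _ fun m => by fin_cases m <;> rfl,
    e 2 ![Sum.inl m, Sum.inl q, Sum.inr p, Sum.inr r] _ fun m => by fin_cases m <;> rfl,
    e 3 ![Sum.inl m, Sum.inl q, Sum.inl s, Sum.inr r] _ fun m => by fin_cases m <;> rfl,
    e 4 ![Sum.inl m, Sum.inl q, Sum.inl s, Sum.inr p] _ fun m => by fin_cases m <;> rfl]
  simp
  ring

theorem extD_llrrr (φ : Coeffs 4) (q s m p r : Fin 3) :
    extD φ ![Sum.inl q, Sum.inl s, Sum.inr m, Sum.inr p, Sum.inr r] z =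
      wirt (Sum.inl q) (φ ![Sum.inl s, Sum.inr m, Sum.inr p, Sum.inr r]) z
      - wirt (Sum.inl s) (φ ![Sum.inl q, Sum.inr m, Sum.inr p, Sum.inr r]) z
      + wirt (Sum.inr m) (φ ![Sum.inl q, Sum.inl s, Sum.inr p, Sum.inr r]) z
      - wirt (Sum.inr p) (φ ![Sum.inl q, Sum.inl s, Sum.inr m, Sum.inr r]) z
      + wirt (Sum.inr r) (φ ![Sum.inl q, Sum.inl s, Sum.inr m, Sum.inr p]) z := by
  have e : ∀ (i : Fin 5) (v : Fin 4 → Idx) (a : Fin 5 → Idx), (∀ m, a (i.succAbove m) = v m) →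
      φ (fun m => a (i.succAbove m)) = φ v := fun i v a h => congrArg φ (funext h)
  simp only [extD, del, delbar, Nat.reduceAdd, Fin.sum_univ_five]
  rw [e 0 ![Sum.inl s, Sum.inr m, Sum.inr p, Sum.inr r] _ fun m => by fin_cases m <;> rfl,
    e 1 ![Sum.inl q, Sum.inr m, Sum.inr p, Sum.inr r] _ fun m => by fin_cases m <;> rfl,
    e 2 ![Sum.inl q, Sum.inl s, Sum.inr p, Sum.inr r] _ fun m => by fin_cases m <;> rfl,
    e 3 ![Sum.inl q, Sum.inl s, Sum.inr m, Sum.inr r] _ fun m => by fin_cases m <;> rfl,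
    e 4 ![Sum.inl q, Sum.inl s, Sum.inr m, Sum.inr p] _ fun m => by fin_cases m <;> rfl]
  simp
  ring

theorem christoffel_lll (j q m : Fin 3) :
    christoffel G (Sum.inl j) (Sum.inl q) (Sum.inl m) z = chernA G j q m z := rfl

theorem christoffel_rrr (j q m : Fin 3) :
    christoffel G (Sum.inr j) (Sum.inr q) (Sum.inr m) z = conj (chernA G j q m z) := rfl

theorem christoffel_lr (j q : Fin 3) (c : Idx) :
    christoffel G (Sum.inl j) (Sum.inr q) c z = 0 := by
  rcases c with c | c <;> rfl

theorem christoffel_rl (j q : Fin 3) (c : Idx) :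
    christoffel G (Sum.inr j) (Sum.inl q) c z = 0 := by
  rcases c with c | c <;> rfl

theorem christoffel_llr (j q m : Fin 3) :
    christoffel G (Sum.inl j) (Sum.inl q) (Sum.inr m) z = 0 := rfl

theorem christoffel_rrl (j q m : Fin 3) :
    christoffel G (Sum.inr j) (Sum.inr q) (Sum.inl m) z = 0 := rfl

theorem nabla_tensor2 (F : Fin 3 → Fin 3 → C3 → ℂ) (j p q : Fin 3) :
    nabla G (tensor2 F) ![Sum.inl j, Sum.inr p, Sum.inl q] z
      = wirt (Sum.inl j) (F p q) z - ∑ c, chernA G j q c z * F p c z := by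
  simp only [nabla, Fin.sum_univ_two, Fintype.sum_sum_type]
  simp [christoffel_lr, christoffel_lll, christoffel_llr]
  rfl

theorem nabla_tensor4 (F : Fin 3 → Fin 3 → Fin 3 → Fin 3 → C3 → ℂ) (j p s r q : Fin 3) :
    nabla G (tensor4 F) ![Sum.inl j, Sum.inr p, Sum.inl s, Sum.inr r, Sum.inl q] z
      = wirt (Sum.inl j) (F p s r q) z - ∑ c, chernA G j s c z * F p c r q z
        - ∑ c, chernA G j q c z * F p s r c z := by
  simp only [nabla, Fin.sum_univ_four, Fintype.sum_sum_type]
  simp [christoffel_lr, christoffel_lll, christoffel_llr, sub_sub]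
  rfl

theorem nabla_torsion_rllr (μ q j p : Fin 3) :
    nabla G (torsion G) ![Sum.inr μ, Sum.inl q, Sum.inl j, Sum.inr p] z
      = wirt (Sum.inr μ) (tor G p j q) z - ∑ c, conj (chernA G μ p c z) * tor G c j q z := by
  simp only [nabla, Fin.sum_univ_three, Fintype.sum_sum_type]
  simp [christoffel_rl, christoffel_rrr, christoffel_rrl, tor]
  rfl

theorem nabla_nabla_torsion (lam μ q j p : Fin 3) :
    nabla G (nabla G (torsion G)) ![Sum.inl lam, Sum.inr μ, Sum.inl q, Sum.inl j, Sum.inr p] z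
      = wirt (Sum.inl lam)
          (nabla G (torsion G) ![Sum.inr μ, Sum.inl q, Sum.inl j, Sum.inr p]) z
        - ∑ c, chernA G lam q c z
            * nabla G (torsion G) ![Sum.inr μ, Sum.inl c, Sum.inl j, Sum.inr p] z
        - ∑ c, chernA G lam j c z
            * nabla G (torsion G) ![Sum.inr μ, Sum.inl q, Sum.inl c, Sum.inr p] z := by
  rw [nabla]
  simp only [Nat.reduceAdd, Fin.sum_univ_four, Fintype.sum_sum_type]
  simp [christoffel_lr, christoffel_lll, christoffel_llr, sub_sub]
  rfl

end Components

open SmoothFun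

variable {τ : ℝ} {U : Set C3}

/-! ### Coordinate metrics as metrics over the ring of smooth functions -/

theorem wirt_congr {f f' : C3 → ℂ} (hU : IsOpen U) (h : ∀ z ∈ U, f z = f' z) (a : Idx) {z : C3}
    (hz : z ∈ U) : wirt a f z = wirt a f' z := by
  have e : f =ᶠ[nhds z] f' := Filter.eventuallyEq_of_mem (hU.mem_nhds hz) h
  rcases a with j | j <;> simp only [wirt, e.fderiv_eq]

theorem wirt_conj (a : Idx) (f : C3 → ℂ) (z : C3) :
    wirt a (fun w => conj (f w)) z = conj (wirt a.swap f z) := by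
  have e : ∀ v, fderiv ℝ (fun w => conj (f w)) z v = conj (fderiv ℝ f z v) := fun v => by
    have := Complex.conjCLE.comp_fderiv (f := f) (x := z)
    have h2 := congrArg (fun L => L v) this
    simpa [Function.comp_def] using h2
  have h2 : conj (2 : ℂ) = 2 := map_ofNat _ 2
  rcases a with j | j <;> simp [wirt, e, h2] <;> ring

theorem wirt_const_mul (a : Idx) (c : ℂ) {f : C3 → ℂ} {z : C3} (hf : DifferentiableAt ℝ f z) :
    wirt a (fun w => c * f w) z = c * wirt a f z := by
  rcases a with j | j <;> simp only [wirt, fderiv_const_mul hf] <;>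
  simp <;> ring

theorem wirt_const (a : Idx) (c : ℂ) (z : C3) : wirt a (fun _ => c) z = 0 := by
  rcases a with j | j <;> simp [wirt]

/-- A family of metrics in coordinates, as a metric over the ring of smooth functions on
space-time. -/
structure Represents (hU : IsOpen U) (G : ℝ → MatFun) (H : HermData (SmoothFun (dom τ U))) :
    Prop where
  dl : ∀ j s, H.dl j s = wirtD τ hU (Sum.inl j) s
  dr : ∀ j s, H.dr j s = wirtD τ hU (Sum.inr j) s
  g : ∀ k j, Rep (fun t z => G t z k j) (H.g k j)
  h : ∀ m k, Rep (fun t z => (G t z)⁻¹ m k) (H.h m k)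
  herm : ∀ t ∈ Set.Ico 0 τ, ∀ z ∈ U, (G t z).IsHermitian

theorem Rep.two : Rep (fun _ _ => 2) (2 : SmoothFun (dom τ U)) := by
  convert (Rep.one (τ := τ) (U := U)).add Rep.one using 1
  · funext _ _; norm_num
  · exact one_add_one_eq_two.symm

/-- Evaluation at a point of `W`. -/
def evalHom {W : Set (ℝ × C3)} {w : ℝ × C3} (hw : w ∈ W) : SmoothFun W →+* ℂ where
  toFun s := s.ext w
  map_one' := ext_one hw
  map_mul' := ext_mul hw
  map_zero' := ext_zero hw
  map_add' := ext_add hw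

theorem map_evalHom {G : ℝ → MatFun} {g : Matrix (Fin 3) (Fin 3) (SmoothFun (dom τ U))}
    (hg : ∀ k j, Rep (fun t z => G t z k j) (g k j)) {t : ℝ} (ht : t ∈ Set.Ico 0 τ) {z : C3}
    (hz : z ∈ U) : G t z = (evalHom (W := dom τ U) (w := (t, z)) ⟨ht, hz⟩).mapMatrix g := by
  ext k j
  exact hg k j t ht z hz

theorem Rep.det {G : ℝ → MatFun} {g : Matrix (Fin 3) (Fin 3) (SmoothFun (dom τ U))}
    (hg : ∀ k j, Rep (fun t z => G t z k j) (g k j)) : Rep (fun t z => (G t z).det) g.det :=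
  fun t ht z hz => by
    simp only [map_evalHom hg ht hz]
    exact (RingHom.map_det _ _).symm

/-- Every smooth family of Hermitian metrics is represented. -/
theorem exists_represents (hU : IsOpen U) (G : ℝ → MatFun)
    (hG : ∀ k j, ContDiffOn ℝ ∞ (fun y : ℝ × C3 => G y.1 y.2 k j) (dom τ U))
    (herm : ∀ t ∈ Set.Ico 0 τ, ∀ z ∈ U, (G t z).IsHermitian)
    (hdet : ∀ t ∈ Set.Ico 0 τ, ∀ z ∈ U, (G t z).det ≠ 0) :
    ∃ H : HermData (SmoothFun (dom τ U)), Represents hU G H := by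
  let g : Matrix (Fin 3) (Fin 3) (SmoothFun (dom τ U)) :=
    Matrix.of fun k j => ofFun (fun y : ℝ × C3 => G y.1 y.2 k j) (hG k j)
  have hg : ∀ k j, Rep (fun t z => G t z k j) (g k j) := fun k j =>
    Rep.of_contDiffOn (fun t z => G t z k j) (hG k j)
  obtain ⟨d, hd, hd1⟩ := (Rep.det hg).exists_inv hdet
  have gh : g * (d • g.adjugate) = 1 := by
    rw [mul_smul_comm, Matrix.mul_adjugate, smul_smul, mul_comm d, hd1, one_smul]
  refine ⟨⟨fun j => wirtD τ hU (Sum.inl j), fun j => wirtD τ hU (Sum.inr j), g, d • g.adjugate,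
    fun _ _ => wirtD_comm hU _ _, fun _ _ => wirtD_comm hU _ _, fun _ _ => wirtD_comm hU _ _, gh⟩,
    fun _ _ => rfl, fun _ _ => rfl, hg, fun m k t ht z hz => ?_, herm⟩
  have e1 : G t z * (evalHom (W := dom τ U) (w := (t, z)) ⟨ht, hz⟩).mapMatrix (d • g.adjugate)
      = 1 := by
    rw [map_evalHom hg ht hz, ← map_mul, gh, map_one]
  simp only [Matrix.inv_eq_right_inv e1]
  rfl

namespace Represents

variable {hU : IsOpen U} {G : ℝ → MatFun} {H : HermData (SmoothFun (dom τ U))}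
  (R : Represents hU G H)

include R

theorem rep_dl {F : ℝ → C3 → ℂ} {s : SmoothFun (dom τ U)} (h : Rep F s) (j : Fin 3) :
    Rep (fun t => wirt (Sum.inl j) (F t)) (H.dl j s) := by
  rw [R.dl]; exact h.wirt hU _

theorem rep_dr {F : ℝ → C3 → ℂ} {s : SmoothFun (dom τ U)} (h : Rep F s) (j : Fin 3) :
    Rep (fun t => wirt (Sum.inr j) (F t)) (H.dr j s) := by
  rw [R.dr]; exact h.wirt hU _

theorem rep_ctr {F : Fin 3 → Fin 3 → ℝ → C3 → ℂ} {X : Fin 3 → Fin 3 → SmoothFun (dom τ U)}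
    (h : ∀ r s, Rep (F r s) (X r s)) :
    Rep (fun t z => ∑ s, ∑ r, (G t z)⁻¹ s r * F r s t z) (H.ctr X) :=
  Rep.sum fun s => Rep.sum fun r => (R.h s r).mul (h r s)

theorem rep_chernA (j q m : Fin 3) : Rep (fun t => chernA (G t) j q m) (H.A j m q) := by
  rw [H.A_apply]
  exact Rep.sum fun k => (R.h m k).mul (R.rep_dl (R.g k q) j)

/-- Conjugation exchanges ∂ with ∂̄ and, since g is Hermitian, transposes g and its inverse. The
result is the connection of `swap`. -/
theorem rep_conj_chernA (j q m : Fin 3) :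
    Rep (fun t z => conj (chernA (G t) j q m z)) (H.swap.A j m q) := by
  rw [H.swap_A_apply]
  refine (Rep.sum (I := Finset.univ) fun k =>
    (R.h k m).mul (R.rep_dr (R.g q k) j)).congr fun t ht z hz => ?_
  have e1 : ∀ k, conj ((G t z)⁻¹ m k) = (G t z)⁻¹ k m := fun k =>
    (R.herm t ht z hz).inv.apply k m
  have e2 : ∀ k, conj (wirt (Sum.inl j) (fun w => G t w k q) z)
      = wirt (Sum.inr j) (fun w => G t w q k) z := fun k => by
    rw [← wirt_congr hU (fun w hw => (R.herm t ht w hw).apply q k) (Sum.inr j) hz]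
    exact (wirt_conj (Sum.inr j) (fun w => G t w k q) z).symm
  simp only [chernA, map_sum, map_mul, e1, e2]

theorem rep_curv (k j p q : Fin 3) : Rep (fun t => curv (G t) k j p q) (H.R k j p q) :=
  (R.rep_dr (R.rep_chernA j q p) k).neg

theorem rep_curvLow (k j l m : Fin 3) : Rep (fun t => curvLow (G t) k j l m) (H.Rl k j l m) := by
  rw [HermData.Rl, Matrix.mul_apply]
  exact Rep.sum fun p => (R.g l p).mul (R.rep_curv k j p m)

theorem rep_curvUp (lam r p j : Fin 3) :
    Rep (fun t => curvUp (G t) lam r p j) (H.Rup lam r p j) :=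
  Rep.sum fun μ => (R.h lam μ).mul (R.rep_curvLow μ r p j)

theorem rep_tor (p j q : Fin 3) : Rep (fun t => tor (G t) p j q) (H.T p j q) := by
  have h := (((R.rep_dl ((R.g p j).smul Complex.I) q).sub
    (R.rep_dl ((R.g p q).smul Complex.I) j)).smul Complex.I).congr
      fun t _ z _ => torsion_llr (G t) z q j p
  have e : Complex.I • (H.dl q (Complex.I • H.g p j) - H.dl j (Complex.I • H.g p q))
      = H.T p j q := by
    rw [Derivation.map_smul, Derivation.map_smul, ← smul_sub, smul_smul, Complex.I_mul_I,
      neg_smul, one_smul, neg_sub]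
    rfl
  rwa [e] at h

theorem rep_torBar (k j m : Fin 3) : Rep (fun t => torBar (G t) k j m) (H.swap.T k j m) := by
  have h := (((R.rep_dr ((R.g j k).smul Complex.I).neg m).sub
    (R.rep_dr ((R.g m k).smul Complex.I).neg j)).smul Complex.I).neg.congr
      fun t _ z _ => torsionBar_rrl (G t) z m j k
  have e : -(Complex.I • (H.dr m (-(Complex.I • H.g j k)) - H.dr j (-(Complex.I • H.g m k))))
      = H.swap.T k j m := by
    rw [map_neg, map_neg, Derivation.map_smul, Derivation.map_smul, ← neg_sub', ← smul_sub,
      smul_neg, neg_neg, smul_smul, Complex.I_mul_I, neg_smul, one_smul, neg_sub]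
    rfl
  rwa [e] at h

theorem rep_torUp (m j q : Fin 3) :
    Rep (fun t => torUp (G t) m j q) (∑ k, H.h m k * H.T k j q) :=
  Rep.sum fun k => (R.h m k).mul (R.rep_tor k j q)

theorem rep_torTr (m : Fin 3) : Rep (fun t => torTr (G t) m) (H.tau m) :=
  R.rep_ctr fun k j => R.rep_tor k j m

theorem rep_TT (k j : Fin 3) : Rep (fun t => TT (G t) k j) (H.TT k j) :=
  Rep.sum fun s => Rep.sum fun r => Rep.sum fun m => Rep.sum fun l =>
    (((R.h s r).mul (R.h m l)).mul (R.rep_tor r m j)).mul (R.rep_torBar s l k)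

theorem rep_nablaTT (j p q : Fin 3) :
    Rep (fun t => nablaTT (G t) j p q) (H.nabla2 H.TT j p q) :=
  ((R.rep_dl (R.rep_TT p q) j).sub (Rep.sum fun c => (R.rep_chernA j q c).mul (R.rep_TT p c))).congr
    fun t _ z _ => nabla_tensor2 (G t) z (TT (G t)) j p q

theorem rep_nabla_torsion (μ q j p : Fin 3) :
    Rep (fun t => nabla (G t) (torsion (G t)) ![Sum.inr μ, Sum.inl q, Sum.inl j, Sum.inr p])
      (H.Z μ p j q) :=
  ((R.rep_dr (R.rep_tor p j q) μ).sub
    (Rep.sum fun c => (R.rep_conj_chernA μ p c).mul (R.rep_tor c j q))).congr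
    fun t _ z _ => nabla_torsion_rllr (G t) z μ q j p

theorem rep_lapTor (p j q : Fin 3) : Rep (fun t => lapTor (G t) p j q) (H.lap p j q) :=
  R.rep_ctr fun μ lam =>
    (((R.rep_dl (R.rep_nabla_torsion μ q j p) lam).sub
      (Rep.sum fun c => (R.rep_chernA lam q c).mul (R.rep_nabla_torsion μ c j p))).sub
      (Rep.sum fun c => (R.rep_chernA lam j c).mul (R.rep_nabla_torsion μ q c p))).congr
      fun t _ z _ => nabla_nabla_torsion (G t) z lam μ q j p

/-- By cyclicity of the trace the four products of the antisymmetrization agree in pairs, whence the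
factor 2 in `trRR`. -/
theorem rep_RR (p s r q : Fin 3) : Rep (fun t => RR (G t) p s r q) (H.trRR p s r q) := by
  have h : Rep (fun t => RR (G t) p s r q) (∑ α, ∑ β,
      (H.R p s α β * H.R r q β α - H.R r s α β * H.R p q β α
        - H.R p q α β * H.R r s β α + H.R r q α β * H.R p s β α)) :=
    Rep.sum fun α => Rep.sum fun β =>
      ((((R.rep_curv p s α β).mul (R.rep_curv r q β α)).sub
        ((R.rep_curv r s α β).mul (R.rep_curv p q β α))).sub
        ((R.rep_curv p q α β).mul (R.rep_curv r s β α))).add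
        ((R.rep_curv r q α β).mul (R.rep_curv p s β α))
  have e : ∀ X Y : Matrix (Fin 3) (Fin 3) (SmoothFun (dom τ U)),
      ∑ α, ∑ β, X α β * Y β α = (X * Y).trace := fun X Y => by
    simp [Matrix.trace, Matrix.mul_apply]
  simp only [Finset.sum_add_distrib, Finset.sum_sub_distrib, e] at h
  rw [Matrix.trace_mul_comm (H.R r s), Matrix.trace_mul_comm (H.R r q)] at h
  rw [HermData.trRR]
  convert h using 1
  ring

theorem rep_del_delbar_llrr (q s p r : Fin 3) :
    Rep (fun t z => Complex.I * del (delbar (kahler (G t)))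
      ![Sum.inl q, Sum.inl s, Sum.inr p, Sum.inr r] z) (H.K p s r q) := by
  have hI := fun a b => (R.g a b).smul Complex.I
  have h := (((R.rep_dl ((R.rep_dr (hI r s) p).neg.add (R.rep_dr (hI p s) r)) q).sub
    (R.rep_dl ((R.rep_dr (hI r q) p).neg.add (R.rep_dr (hI p q) r)) s)).smul Complex.I).congr
    fun t _ z _ => congrArg (Complex.I * ·) (del_delbar_llrr (G t) z q s p r)
  convert h using 1
  simp only [Derivation.map_smul, map_add, map_neg, smul_add, smul_sub, smul_neg, smul_smul,
    Complex.I_mul_I, neg_smul, one_smul, HermData.K]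
  ring

theorem rep_del_delbar_lrlr (q s p r : Fin 3) :
    Rep (fun t z => Complex.I * del (delbar (kahler (G t)))
      ![Sum.inl q, Sum.inr r, Sum.inl s, Sum.inr p] z) (H.K p s r q) := by
  have hI := fun a b => (R.g a b).smul Complex.I
  have h := (((R.rep_dl ((R.rep_dr (hI p s) r).add (R.rep_dr (hI r s).neg p)) q).add
    (R.rep_dl ((R.rep_dr (hI p q) r).neg.add (R.rep_dr (hI r q) p)) s)).smul Complex.I).congr
    fun t _ z _ => congrArg (Complex.I * ·) (del_delbar_lrlr (G t) z q s p r)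
  convert h using 1
  simp only [Derivation.map_smul, map_add, map_neg, smul_add, smul_neg, smul_smul,
    Complex.I_mul_I, neg_smul, one_smul, HermData.K]
  ring

end Represents

open SmoothFun

open scoped ComplexOrder

/-! ## The norm of the holomorphic volume form -/

/-- A (3,0)-form must receive the three unbarred vectors, so only the identity shuffle contributes.
-/
theorem wedge_conjC_top (C : Coeffs 3) (hC : ∀ a z, ¬(∀ i, (a i).isLeft) → C a z = 0) (z : C3) :
    wedge C (conjC C) topFrame z = C ![Sum.inl 0, Sum.inl 1, Sum.inl 2] z
      * conj (C ![Sum.inl 0, Sum.inl 1, Sum.inl 2] z) := by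
  have h1 : ∀ σ : Equiv.Perm (Fin (3 + 3)), 
      ((∀ i j : Fin 3, i < j → σ (Fin.castAdd 3 i) < σ (Fin.castAdd 3 j)) ∧
      (∀ i j : Fin 3, i < j → σ (Fin.natAdd 3 i) < σ (Fin.natAdd 3 j))) →
      (∀ i : Fin 3, σ (Fin.castAdd 3 i) < 3) → σ = 1 := by decide +kernel
  have h2 : ∀ n : Fin 6, ((topFrame n).isLeft = true) → n < 3 := by decide +kernel
  rw [wedge, Finset.sum_eq_single 1]
  · have e1 : (fun i => topFrame ((1 : Equiv.Perm (Fin (3 + 3))) (Fin.castAdd 3 i)))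
        = ![Sum.inl 0, Sum.inl 1, Sum.inl 2] := by funext i; fin_cases i <;> rfl
    have e2 : (fun i => (topFrame ((1 : Equiv.Perm (Fin (3 + 3))) (Fin.natAdd 3 i))).swap)
        = ![Sum.inl 0, Sum.inl 1, Sum.inl 2] := by funext i; fin_cases i <;> rfl
    rw [conjC, e1, e2]
    simp
  · intro σ hσ h
    rw [hC, mul_zero, zero_mul]
    intro hl
    exact h (h1 σ (Finset.mem_filter.mp hσ).2 fun i => h2 _ (hl i))
  · intro h
    refine absurd (Finset.mem_filter.mpr ⟨Finset.mem_univ _, ?_⟩) h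
    decide +kernel

/-! ### The flow in a coordinate domain -/

/-- The coordinate expression of a solution of the Anomaly flow. -/
structure LocalFlow (τ : ℝ) (U : Set C3) (Om : Coeffs 3) (α' : ℝ) (Phi : ℝ → Coeffs 4)
    (G : ℝ → MatFun) : Prop where
  isOpen : IsOpen U
  smooth : ∀ k j, ContDiffOn ℝ ∞ (fun y : ℝ × C3 => G y.1 y.2 k j) (dom τ U)
  posDef : ∀ t ∈ Set.Ico 0 τ, ∀ z ∈ U, (G t z).PosDef
  om_type : ∀ a z, ¬(∀ i, (a i).isLeft) → Om a z = 0
  om_smooth : ContDiffOn ℝ ∞ (Om ![Sum.inl 0, Sum.inl 1, Sum.inl 2]) U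
  om_ne_zero : ∀ z ∈ U, Om ![Sum.inl 0, Sum.inl 1, Sum.inl 2] z ≠ 0
  om_holomorphic : ∀ k, ∀ z ∈ U, wirt (Sum.inr k) (Om ![Sum.inl 0, Sum.inl 1, Sum.inl 2]) z = 0
  phi_smooth : ∀ t ∈ Set.Ico 0 τ, ∀ a, ContDiffOn ℝ ∞ (Phi t a) U
  phi_type : ∀ t ∈ Set.Ico 0 τ, ∀ z ∈ U, ∀ a : Fin 4 → Idx,
    (Finset.univ.filter fun i => (a i).isLeft).card ≠ 2 → Phi t a z = 0
  phi_closed : ∀ t ∈ Set.Ico 0 τ, ∀ z ∈ U, ∀ a, extD (Phi t) a z = 0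
  flow : ∀ t ∈ Set.Ico 0 τ, ∀ z ∈ U, ∀ a,
    HasDerivWithinAt (fun s => balancedForm Om (G s) a z) (Psi α' (Phi t) (G t) a z)
      (Set.Ico 0 τ) t
  balanced : ∀ z ∈ U, ∀ a, extD (balancedForm Om (G 0)) a z = 0

namespace LocalFlow

variable {τ : ℝ} {U : Set C3} {Om : Coeffs 3} {α' : ℝ} {Phi : ℝ → Coeffs 4} {G : ℝ → MatFun}
  (L : LocalFlow τ U Om α' Phi G)

include L

theorem normOm_eq {t : ℝ} {z : C3} : normOm Om (G t) z
    = Real.sqrt (Om ![Sum.inl 0, Sum.inl 1, Sum.inl 2] z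
      * conj (Om ![Sum.inl 0, Sum.inl 1, Sum.inl 2] z) * (6 * (G t z).det)⁻¹).re := by
  have e1 := wedge_conjC_top Om L.om_type z
  have e2 := wedge_kahler_top (G t) z
  have e : normOm Om (G t) z = Real.sqrt (Complex.I * wedge Om (conjC Om) topFrame z
    / wedge (wedge (kahler (G t)) (kahler (G t))) (kahler (G t)) topFrame z).re := rfl
  rw [e, e1, e2, mul_div_mul_left _ _ Complex.I_ne_zero, div_eq_mul_inv]

theorem ratio_pos {t : ℝ} (ht : t ∈ Set.Ico 0 τ) {z : C3} (hz : z ∈ U) :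
    0 < Om ![Sum.inl 0, Sum.inl 1, Sum.inl 2] z
      * conj (Om ![Sum.inl 0, Sum.inl 1, Sum.inl 2] z) * (6 * (G t z).det)⁻¹ := by
  have h1 : 0 < (G t z).det := (L.posDef t ht z hz).det_pos
  have h2 : 0 < Om ![Sum.inl 0, Sum.inl 1, Sum.inl 2] z
      * conj (Om ![Sum.inl 0, Sum.inl 1, Sum.inl 2] z) := by
    rw [Complex.mul_conj]
    exact_mod_cast Complex.normSq_pos.mpr (L.om_ne_zero z hz)
  rw [Complex.lt_def] at h1 h2 ⊢
  have e1 : (G t z).det = ((G t z).det.re : ℂ) := Complex.ext rfl h1.2.symm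
  rw [e1, Complex.mul_conj]
  rw [Complex.mul_conj] at h2
  have h3 := h2.1
  simp only [Complex.zero_re, Complex.ofReal_re] at h3 h1
  have h4 := mul_pos h3 (inv_pos.mpr (mul_pos (by norm_num : (0 : ℝ) < 6) h1.1))
  rw [← Complex.lt_def]
  exact_mod_cast h4

/-- Taking the real part and the square root loses nothing, because the quotient is a positive real
number by `ratio_pos`. -/
theorem normOm_sq {t : ℝ} (ht : t ∈ Set.Ico 0 τ) {z : C3} (hz : z ∈ U) :
    (normOm Om (G t) z : ℂ) * normOm Om (G t) z * (G t z).det * 6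
      = Om ![Sum.inl 0, Sum.inl 1, Sum.inl 2] z
        * conj (Om ![Sum.inl 0, Sum.inl 1, Sum.inl 2] z) := by
  have hp := L.ratio_pos ht hz
  have hd : (G t z).det ≠ 0 := (L.posDef t ht z hz).det_pos.ne'
  have h1 := Complex.lt_def.mp hp
  have e : (normOm Om (G t) z : ℂ) * normOm Om (G t) z = Om ![Sum.inl 0, Sum.inl 1, Sum.inl 2] z
      * conj (Om ![Sum.inl 0, Sum.inl 1, Sum.inl 2] z) * (6 * (G t z).det)⁻¹ := by
    rw [← Complex.ofReal_mul, L.normOm_eq, Real.mul_self_sqrt h1.1.le]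
    exact Complex.ext rfl h1.2
  rw [e]
  field_simp

theorem normOm_ne_zero {t : ℝ} (ht : t ∈ Set.Ico 0 τ) {z : C3} (hz : z ∈ U) :
    (normOm Om (G t) z : ℂ) ≠ 0 := by
  rw [L.normOm_eq]
  exact_mod_cast (Real.sqrt_pos.mpr (Complex.lt_def.mp (L.ratio_pos ht hz)).1).ne'

theorem exists_represents :
    ∃ H : HermData (SmoothFun (dom τ U)), Represents L.isOpen G H :=
  AnomalyFlow.exists_represents L.isOpen G L.smooth (fun t ht z hz => (L.posDef t ht z hz).1)
    fun t ht z hz => (L.posDef t ht z hz).det_pos.ne'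

/-- The holomorphic coefficient of `Ω` and its conjugate. -/
theorem exists_om : ∃ f fb : SmoothFun (dom τ U),
    Rep (fun _ z => Om ![Sum.inl 0, Sum.inl 1, Sum.inl 2] z) f ∧
    Rep (fun _ z => conj (Om ![Sum.inl 0, Sum.inl 1, Sum.inl 2] z)) fb := by
  have h1 : ContDiffOn ℝ ∞ (fun y : ℝ × C3 => Om ![Sum.inl 0, Sum.inl 1, Sum.inl 2] y.2)
      (dom τ U) := L.om_smooth.comp contDiff_snd.contDiffOn fun y hy => hy.2
  have h2 : ContDiffOn ℝ ∞ (fun y : ℝ × C3 => conj (Om ![Sum.inl 0, Sum.inl 1, Sum.inl 2] y.2))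
      (dom τ U) := Complex.conjCLE.contDiff.comp_contDiffOn h1
  exact ⟨_, _, Rep.of_contDiffOn (fun _ z => Om ![Sum.inl 0, Sum.inl 1, Sum.inl 2] z) h1,
    Rep.of_contDiffOn (fun _ z => conj (Om ![Sum.inl 0, Sum.inl 1, Sum.inl 2] z)) h2⟩

theorem exists_norm {H : HermData (SmoothFun (dom τ U))} (R : Represents L.isOpen G H) :
    ∃ N : SmoothFun (dom τ U), Rep (fun t z => (normOm Om (G t) z : ℂ)) N := by
  obtain ⟨f, fb, hf, hfb⟩ := L.exists_om
  obtain ⟨d, hd, -⟩ := ((Rep.det R.g).smul 6).exists_inv fun t ht z hz =>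
    mul_ne_zero (by norm_num) (L.posDef t ht z hz).det_pos.ne'
  obtain ⟨N, hN⟩ := ((hf.mul hfb).mul hd).exists_sqrt fun t ht z hz =>
    (Complex.lt_def.mp (L.ratio_pos ht hz)).1
  exact ⟨N, hN.congr fun t _ z _ => by rw [L.normOm_eq]⟩

end LocalFlow

open SmoothFun

namespace LocalFlow

variable {τ : ℝ} {U : Set C3} {Om : Coeffs 3} {α' : ℝ} {Phi : ℝ → Coeffs 4} {G : ℝ → MatFun}
  (L : LocalFlow τ U Om α' Phi G) {H : HermData (SmoothFun (dom τ U))}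
  (R : Represents L.isOpen G H) {N : SmoothFun (dom τ U)}
  (hN : Rep (fun t z => (normOm Om (G t) z : ℂ)) N)

/-! ### Persistence of the conformally balanced condition -/

include R hN in
theorem rep_balancedForm_llrr (q s p r : Fin 3) :
    Rep (fun t => balancedForm Om (G t) ![Sum.inl q, Sum.inl s, Sum.inr p, Sum.inr r])
      (N * (2 * H.b q s p r)) :=
  (hN.mul (Rep.two.mul (((R.g p q).mul (R.g r s)).sub ((R.g r q).mul (R.g p s))))).congr
    fun t _ z _ => by rw [balancedForm, wedge_kahler_llrr]

include R hN in
theorem rep_balancedForm_lrlr (q s p r : Fin 3) :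
    Rep (fun t => balancedForm Om (G t) ![Sum.inl q, Sum.inr r, Sum.inl s, Sum.inr p])
      (N * (2 * H.b q s p r)) :=
  (hN.mul (Rep.two.mul (((R.g p q).mul (R.g r s)).sub ((R.g r q).mul (R.g p s))))).congr
    fun t _ z _ => by rw [balancedForm, wedge_kahler_lrlr]

-- Φ is only assumed smooth in space for each fixed t. Joint smoothness of Ψ comes from the flow
-- itself, which makes Ψ a time derivative of a smooth function on space-time.
include R hN in
theorem rep_Psi_llrr (q s p r : Fin 3) :
    Rep (fun t => Psi α' (Phi t) (G t) ![Sum.inl q, Sum.inl s, Sum.inr p, Sum.inr r])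
      (timeD τ L.isOpen (N * (2 * H.b q s p r))) :=
  (L.rep_balancedForm_llrr R hN q s p r).timeD_of_hasDerivWithinAt L.isOpen
    fun t ht z hz => L.flow t ht z hz _

include R hN in
theorem rep_Psi_lrlr (q s p r : Fin 3) :
    Rep (fun t => comp22 (Psi α' (Phi t) (G t)) p s r q)
      (timeD τ L.isOpen (N * (2 * H.b q s p r))) :=
  (L.rep_balancedForm_lrlr R hN q s p r).timeD_of_hasDerivWithinAt L.isOpen
    fun t ht z hz => L.flow t ht z hz _

/-- The components of `α' (Tr (Rm ∧ Rm) - Φ)`, as functions on space-time. -/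
def source (H : HermData (SmoothFun (dom τ U))) (N : SmoothFun (dom τ U)) (p s r q : Fin 3) :
    SmoothFun (dom τ U) :=
  H.K p s r q - timeD τ L.isOpen (N * (2 * H.b q s p r))

include R hN in
theorem rep_source (p s r q : Fin 3) :
    Rep (fun t z => (α' : ℂ) * (RR (G t) p s r q z - comp22 (Phi t) p s r q z))
      (L.source H N p s r q) :=
  ((R.rep_del_delbar_lrlr q s p r).sub (L.rep_Psi_lrlr R hN q s p r)).congr fun t _ z _ => by
    rw [comp22, comp22, Psi, trRmRm_lrlr]; ring

-- Only the product α'Φ is represented: it can be solved for from the flow equation, whereas Φ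
-- itself cannot when α' = 0.
include R hN in
theorem rep_phi (p s r q : Fin 3) :
    Rep (fun t z => (α' : ℂ) * Phi t ![Sum.inl q, Sum.inl s, Sum.inr p, Sum.inr r] z)
      ((α' : ℂ) • H.trRR p s r q - L.source H N p s r q) :=
  (((R.rep_RR p s r q).smul (α' : ℂ)).sub
    ((R.rep_del_delbar_llrr q s p r).sub (L.rep_Psi_llrr R hN q s p r))).congr
    fun t _ z _ => by rw [Psi, trRmRm_llrr]; ring

include L in
theorem wirt_phi {t : ℝ} (ht : t ∈ Set.Ico 0 τ) {z : C3} (hz : z ∈ U) (a : Idx)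
    (b : Fin 4 → Idx) :
    wirt a (fun w => (α' : ℂ) * Phi t b w) z = α' * wirt a (Phi t b) z :=
  wirt_const_mul a _ (((L.phi_smooth t ht b).differentiableOn (by simp)).differentiableAt
    (L.isOpen.mem_nhds hz))

include L in
theorem wirt_phi_eq_zero {t : ℝ} (ht : t ∈ Set.Ico 0 τ) {z : C3} (hz : z ∈ U) (a : Idx)
    {b : Fin 4 → Idx} (hb : (Finset.univ.filter fun i => (b i).isLeft).card ≠ 2) :
    wirt a (Phi t b) z = 0 := by
  rw [wirt_congr L.isOpen (fun w hw => L.phi_type t ht w hw b hb) a hz, wirt_const]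

include L in
theorem wirt_phi_lllr {t : ℝ} (ht : t ∈ Set.Ico 0 τ) {z : C3} (hz : z ∈ U) (a : Idx)
    (i j k l : Fin 3) : wirt a (Phi t ![Sum.inl i, Sum.inl j, Sum.inl k, Sum.inr l]) z = 0 := by
  refine L.wirt_phi_eq_zero ht hz a ?_
  have : (Finset.univ.filter fun m : Fin 4 =>
      ((![Sum.inl i, Sum.inl j, Sum.inl k, Sum.inr l] : Fin 4 → Idx) m).isLeft).card = 3 := rfl
  rw [this]; norm_num

include L in
theorem wirt_phi_lrrr {t : ℝ} (ht : t ∈ Set.Ico 0 τ) {z : C3} (hz : z ∈ U) (a : Idx)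
    (i j k l : Fin 3) : wirt a (Phi t ![Sum.inl i, Sum.inr j, Sum.inr k, Sum.inr l]) z = 0 := by
  refine L.wirt_phi_eq_zero ht hz a ?_
  have : (Finset.univ.filter fun m : Fin 4 =>
      ((![Sum.inl i, Sum.inr j, Sum.inr k, Sum.inr l] : Fin 4 → Idx) m).isLeft).card = 1 := rfl
  rw [this]; norm_num

-- Since Φ has type (2,2), dΦ = 0 splits by type into ∂Φ = 0 and ∂̄Φ = 0. The trace part is closed
-- by `trRR_closed_left`.
include R hN in
theorem source_closed_left (m q s p r : Fin 3) :
    H.dl m (L.source H N p s r q) - H.dl q (L.source H N p s r m)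
      + H.dl s (L.source H N p q r m) = 0 := by
  have h := ((R.rep_dl (L.rep_phi R hN p s r q) m).sub (R.rep_dl (L.rep_phi R hN p s r m) q)).add
    (R.rep_dl (L.rep_phi R hN p q r m) s)
  have h0 := h.unique (Rep.zero.congr fun t ht z hz => by
    rw [L.wirt_phi ht hz, L.wirt_phi ht hz, L.wirt_phi ht hz]
    have e := L.phi_closed t ht z hz
      ![Sum.inl m, Sum.inl q, Sum.inl s, Sum.inr p, Sum.inr r]
    rw [extD_lllrr, L.wirt_phi_lllr ht hz, L.wirt_phi_lllr ht hz] at e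
    linear_combination (α' : ℂ) * e)
  simp only [map_sub, Derivation.map_smul] at h0
  have hc := congrArg ((α' : ℂ) • ·) (H.trRR_closed_left m q s p r)
  simp only [smul_add, smul_sub, smul_zero] at hc
  linear_combination hc - h0

include R hN in
theorem source_closed_right (m q s p r : Fin 3) :
    H.dr m (L.source H N p s r q) - H.dr p (L.source H N m s r q)
      + H.dr r (L.source H N m s p q) = 0 := by
  have h := ((R.rep_dr (L.rep_phi R hN p s r q) m).sub (R.rep_dr (L.rep_phi R hN m s r q) p)).add
    (R.rep_dr (L.rep_phi R hN m s p q) r)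
  have h0 := h.unique (Rep.zero.congr fun t ht z hz => by
    rw [L.wirt_phi ht hz, L.wirt_phi ht hz, L.wirt_phi ht hz]
    have e := L.phi_closed t ht z hz
      ![Sum.inl q, Sum.inl s, Sum.inr m, Sum.inr p, Sum.inr r]
    rw [extD_llrrr, L.wirt_phi_lrrr ht hz, L.wirt_phi_lrrr ht hz] at e
    linear_combination (α' : ℂ) * e)
  simp only [map_sub, Derivation.map_smul] at h0
  have hc := congrArg ((α' : ℂ) • ·) (H.trRR_closed_right m q s p r)
  simp only [smul_add, smul_sub, smul_zero] at hc
  linear_combination hc - h0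

include R in
theorem timeD_dl (j : Fin 3) (s : SmoothFun (dom τ U)) :
    timeD τ L.isOpen (H.dl j s) = H.dl j (timeD τ L.isOpen s) := by
  rw [R.dl, R.dl]; exact timeD_comm _ _ _

include R in
theorem timeD_dr (j : Fin 3) (s : SmoothFun (dom τ U)) :
    timeD τ L.isOpen (H.dr j s) = H.dr j (timeD τ L.isOpen s) := by
  rw [R.dr, R.dr]; exact timeD_comm _ _ _

theorem eq_zero_of_two_mul {S : Type*} [CommRing S] [Algebra ℂ S] {x : S} (h : 2 * x = 0) :
    x = 0 := by
  have := congrArg (fun w => (1 / 2 : ℂ) • w) h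
  simpa [two_mul, ← two_smul ℂ, smul_smul] using this

theorem derivation_mul_two_mul {S : Type*} [CommRing S] [Algebra ℂ S] (d : Derivation ℂ S S)
    (a b : S) : d (a * (2 * b)) = 2 * d (a * b) := by
  rw [mul_left_comm, d.leibniz, derivation_two]; simp

include R hN in
/-- The metric remains conformally balanced. -/
theorem balanced_left (m q s p r : Fin 3) :
    H.dl m (N * H.b q s p r) - H.dl q (N * H.b m s p r) + H.dl s (N * H.b m q p r) = 0 := by
  have hB := L.rep_balancedForm_llrr R hN
  have h := ((R.rep_dl (hB q s p r) m).sub (R.rep_dl (hB m s p r) q)).add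
    (R.rep_dl (hB m q p r) s)
  -- This is the (3,2) component of d(Nω²). It vanishes at t = 0 by hypothesis, where the barred
  -- derivatives drop out because ω² has no (3,1) part; its time derivative vanishes because i∂∂̄ω
  -- and the source term are both closed.
  have h0 := h.eq_zero_of_timeD L.isOpen (fun z hz => by
    have e := L.balanced z hz ![Sum.inl m, Sum.inl q, Sum.inl s, Sum.inr p, Sum.inr r]
    have e0 : ∀ r, balancedForm Om (G 0) ![Sum.inl m, Sum.inl q, Sum.inl s, Sum.inr r]
        = fun _ => 0 := fun r => by
      funext w; rw [balancedForm, wedge_kahler_lllr, mul_zero]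
    rw [extD_lllrr, e0, e0, wirt_const, wirt_const] at e
    linear_combination e) (by
    have e1 := L.source_closed_left R hN m q s p r
    have e2 := H.K_closed_left m q s p r
    simp only [source, map_sub] at e1
    simp only [map_add, map_sub, L.timeD_dl R]
    linear_combination e2 - e1)
  simp only [derivation_mul_two_mul] at h0
  exact eq_zero_of_two_mul (by linear_combination h0)

include R hN in
theorem balanced_right (m q s p r : Fin 3) :
    H.dr m (N * H.b q s p r) - H.dr p (N * H.b q s m r) + H.dr r (N * H.b q s m p) = 0 := by
  have hB := L.rep_balancedForm_llrr R hN
  have h := ((R.rep_dr (hB q s p r) m).sub (R.rep_dr (hB q s m r) p)).add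
    (R.rep_dr (hB q s m p) r)
  have h0 := h.eq_zero_of_timeD L.isOpen (fun z hz => by
    have e := L.balanced z hz ![Sum.inl q, Sum.inl s, Sum.inr m, Sum.inr p, Sum.inr r]
    have e0 : ∀ q, balancedForm Om (G 0) ![Sum.inl q, Sum.inr m, Sum.inr p, Sum.inr r]
        = fun _ => 0 := fun r => by
      funext w; rw [balancedForm, wedge_kahler_lrrr, mul_zero]
    rw [extD_llrrr, e0, e0, wirt_const, wirt_const] at e
    linear_combination e) (by
    have e1 := L.source_closed_right R hN m q s p r
    have e2 := H.K_closed_right m q s p r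
    simp only [source, map_sub] at e1
    simp only [map_add, map_sub, L.timeD_dr R]
    linear_combination e2 - e1)
  simp only [derivation_mul_two_mul] at h0
  exact eq_zero_of_two_mul (by linear_combination h0)

include R hN in
theorem dl_norm (m : Fin 3) : H.dl m N = N * H.tau m :=
  H.dl_eq_of_balanced N (L.balanced_left R hN) m

-- The balanced argument applied to the conjugate structure, for which the (2,3) component of d(Nω²)
-- plays the role of the (3,2) component.
include R hN in
theorem dr_norm (m : Fin 3) : H.dr m N = N * H.swap.tau m := by
  refine H.swap.dl_eq_of_balanced N (fun m q s p r => ?_) m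
  have e : ∀ q s, H.swap.b q s p r = H.b p r q s := fun q s => by
    simp only [HermData.b, HermData.swap, Matrix.transpose_apply]; ring
  rw [e, e, e]
  exact L.balanced_right R hN m p r q s

include R hN in
/-- The curvature and volume identities for a conformally balanced solution. -/
theorem norm_identities :
    (2 * timeD τ L.isOpen N + N * H.ctr (fun r s => timeD τ L.isOpen (H.g r s)) = 0) ∧
    (∀ p q, 2 * H.dr p (H.tau q) = H.ric p q) ∧
    (∀ p q, 2 * H.dl q (H.swap.tau p) = H.ric p q) := by
  obtain ⟨f, fb, hf, hfb⟩ := L.exists_om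
  obtain ⟨Ni, -, hNi⟩ := hN.exists_inv fun t ht z hz => L.normOm_ne_zero ht hz
  obtain ⟨fi, -, hfi⟩ := hf.exists_inv fun t ht z hz => L.om_ne_zero z hz
  obtain ⟨fbi, -, hfbi⟩ := hfb.exists_inv fun t ht z hz =>
    (map_ne_zero (starRingEnd ℂ)).mpr (L.om_ne_zero z hz)
  have hF : IsUnit (f * fb) := (IsUnit.of_mul_eq_one _ hfi).mul (IsUnit.of_mul_eq_one _ hfbi)
  have h6 : (6 : SmoothFun (dom τ U)) = 2 * (2 + 1) := by norm_num
  have hsq : N * N * H.g.det * 6 = f * fb := by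
    have hr := (((hN.mul hN).mul (Rep.det R.g)).mul (Rep.two.mul (Rep.two.add Rep.one)))
    rw [← h6] at hr
    exact hr.unique ((hf.mul hfb).congr fun t ht z hz => by
      rw [← L.normOm_sq ht hz]; norm_num)
  have hfr : ∀ k, H.dr k f = 0 := fun k =>
    (R.rep_dr hf k).unique (Rep.zero.congr fun t ht z hz => L.om_holomorphic k z hz)
  have hfl : ∀ k, H.dl k fb = 0 := fun k =>
    (R.rep_dl hfb k).unique (Rep.zero.congr fun t ht z hz => by
      rw [wirt_conj]; simp [L.om_holomorphic k z hz])
  -- Ω is independent of time, hence so is N² det g; this gives the first identity.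
  have hft : timeD τ L.isOpen (f * fb) = 0 :=
    ((hf.mul hfb).timeD_of_hasDerivWithinAt (F' := fun _ _ => 0) L.isOpen
      fun t ht z hz => hasDerivWithinAt_const _ _ _).unique Rep.zero
  have htau : ∀ q, H.tau q = Ni * H.dl q N := fun q => by
    rw [L.dl_norm R hN]; linear_combination -(H.tau q) * hNi
  have htaub : ∀ q, H.swap.tau q = Ni * H.dr q N := fun q => by
    rw [L.dr_norm R hN]; linear_combination -(H.swap.tau q) * hNi
  refine ⟨?_, fun p q => ?_, fun p q => ?_⟩
  · have e := H.derivation_of_sq_mul_det (timeD τ L.isOpen) hNi hsq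
    rw [hft] at e
    have e2 := hF.mul_right_eq_zero.mp e.symm
    linear_combination N * e2 - 2 * timeD τ L.isOpen N * hNi
  · rw [htau]
    exact H.dr_log_eq_ric hNi hfi hF hsq hfr hfl p q
  · rw [htaub, ← H.swap_ric]
    refine H.swap.dr_log_eq_ric hNi hfbi (by rwa [mul_comm]) ?_ hfl hfr q p
    rw [mul_comm fb, ← hsq]
    simp only [HermData.swap, Matrix.det_transpose]

/-! ### Evolution of the torsion in coordinates -/

include R hN in
theorem rep_nablaRRPhi (j p q : Fin 3) :
    Rep (fun t z => (α' : ℂ) * nablaRRPhi (Phi t) (G t) j p q z)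
      (H.nablaE (L.source H N) j p q) := by
  have hs := L.rep_source R hN
  refine (R.rep_ctr fun r s => ((R.rep_dl (hs p s r q) j).sub
    (Rep.sum (I := Finset.univ) fun c => (R.rep_chernA j s c).mul (hs p c r q))).sub
    (Rep.sum (I := Finset.univ) fun c => (R.rep_chernA j q c).mul (hs p s r c))).congr
    fun t ht z hz => ?_
  -- Moving α' out of the derivative requires only differentiability in space at the fixed time t.
  have e : ∀ s r, wirt (Sum.inl j)
      (fun w => (α' : ℂ) * (RR (G t) p s r q w - comp22 (Phi t) p s r q w)) z
      = α' * wirt (Sum.inl j) (fun w => RR (G t) p s r q w - comp22 (Phi t) p s r q w) z :=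
    fun s r => wirt_const_mul _ _
      ((((R.rep_RR p s r q).contDiffOn_slice ht).sub (L.phi_smooth t ht _)).differentiableOn
        (by simp) |>.differentiableAt (L.isOpen.mem_nhds hz))
  have e' : ∀ a F : Fin 3 → ℂ, ∑ c, a c * ((α' : ℂ) * F c) = α' * ∑ c, a c * F c := fun a F => by
    rw [Finset.mul_sum]; exact Finset.sum_congr rfl fun _ _ => mul_left_comm _ _ _
  simp only [nablaRRPhi, nabla_tensor4, Finset.mul_sum (a := ((α' : ℂ)))]
  refine Finset.sum_congr rfl fun s _ => Finset.sum_congr rfl fun r _ => ?_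
  rw [e, e' (fun c => chernA (G t) j s c z), e' (fun c => chernA (G t) j q c z)]
  ring

include R hN in
theorem rep_Psi2 (p q : Fin 3) :
    Rep (fun t => Psi2 α' (Phi t) (G t) p q)
      (H.ctr fun r s => timeD τ L.isOpen (N * (2 * H.b q s p r))) :=
  R.rep_ctr fun r s => L.rep_Psi_lrlr R hN q s p r

include L in
/-- The evolution of the torsion in coordinates. -/
theorem hasDerivWithinAt_tor {t : ℝ} (ht : t ∈ Set.Ico 0 τ) {z : C3} (hz : z ∈ U)
    (p j q : Fin 3) :
    HasDerivWithinAt (fun s => tor (G s) p j q z)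
      (1 / (2 * (normOm Om (G t) z : ℂ)) *
          (lapTor (G t) p j q z - (α' : ℂ) * nablaRRPhi (Phi t) (G t) j p q z
            + (α' : ℂ) * nablaRRPhi (Phi t) (G t) q p j z)
        + 1 / (2 * (normOm Om (G t) z : ℂ)) *
          ((∑ m, torUp (G t) m j q z * Psi2 α' (Phi t) (G t) p m z)
            - torTr (G t) j z * Psi2 α' (Phi t) (G t) p q z
            + torTr (G t) q z * Psi2 α' (Phi t) (G t) p j z
            + nablaTT (G t) j p q z - nablaTT (G t) q p j z)
        - 1 / (2 * (normOm Om (G t) z : ℂ)) *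
          ((∑ r, ∑ l, torUp (G t) r q l z * curvUp (G t) l r p j z)
            - ∑ r, ∑ l, torUp (G t) r j l z * curvUp (G t) l r p q z))
      (Set.Ico 0 τ) t := by
  obtain ⟨H, R⟩ := L.exists_represents
  obtain ⟨N, hN⟩ := L.exists_norm R
  obtain ⟨hNt, h1, h2⟩ := L.norm_identities R hN
  have key := H.evolution_torsion (timeD τ L.isOpen) (L.timeD_dl R) N (L.source H N)
    (fun p q => H.ctr fun r s => timeD τ L.isOpen (N * (2 * H.b q s p r)))
    (fun p s r q => by rw [source, derivation_mul_two_mul, sub_sub_cancel])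
    (fun p q => by simp only [derivation_mul_two_mul]) hNt (L.dl_norm R hN) h1 h2 p j q
  have hd := (R.rep_tor p j q).hasDerivWithinAt L.isOpen ht hz
  have hl : Rep (fun t z => 2 * (normOm Om (G t) z : ℂ)
      * (timeD τ L.isOpen (H.T p j q)).ext (t, z)) _ :=
    (Rep.two.mul hN).mul (s' := timeD τ L.isOpen (H.T p j q)) fun _ _ _ _ => rfl
  have hPsi := L.rep_Psi2 R hN
  have hr := ((((R.rep_lapTor p j q).sub (L.rep_nablaRRPhi R hN j p q)).add
      (L.rep_nablaRRPhi R hN q p j)).add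
    (((((Rep.sum (I := Finset.univ) fun m => (R.rep_torUp m j q).mul (hPsi p m)).sub
      ((R.rep_torTr j).mul (hPsi p q))).add ((R.rep_torTr q).mul (hPsi p j))).add
      (R.rep_nablaTT j p q)).sub (R.rep_nablaTT q p j))).sub
    ((Rep.sum (I := Finset.univ) fun r => Rep.sum (I := Finset.univ) fun l =>
      (R.rep_torUp r q l).mul (R.rep_curvUp l r p j)).sub
    (Rep.sum (I := Finset.univ) fun r => Rep.sum (I := Finset.univ) fun l =>
      (R.rep_torUp r j l).mul (R.rep_curvUp l r p q)))
  rw [key] at hl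
  have e := (hl t ht z hz).trans (hr t ht z hz).symm
  have hn : (normOm Om (G t) z : ℂ) ≠ 0 := L.normOm_ne_zero ht hz
  convert hd using 1
  simp only at e
  -- The ring identity evaluated at (t, z) expresses 2N ∂_t T; division by 2N is allowed since N
  -- does not vanish.
  rw [← mul_add, ← mul_sub, ← e]
  field_simp

end LocalFlow

/-! ## Coordinate expressions on a complex threefold -/

section Manifold

open scoped ComplexOrder

variable {X : Type*} [TopologicalSpace X] [ChartedSpace C3 X]

theorem mdifferentiable_of_mem_holCharts {e : OpenPartialHomeomorph X C3} (he : e ∈ holCharts X) :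
    e.MDifferentiable 𝓘(ℂ, C3) 𝓘(ℂ, C3) :=
  ⟨(contMDiffOn_of_mem_maximalAtlas he).mdifferentiableOn (by simp),
    (contMDiffOn_symm_of_mem_maximalAtlas he).mdifferentiableOn (by simp)⟩

/-- The coordinate isomorphism onto the holomorphic tangent space. -/
def coordEquiv {e : OpenPartialHomeomorph X C3} (he : e ∈ holCharts X) {z : C3}
    (hz : z ∈ e.target) : C3 ≃ₗ[ℂ] TangentSpace 𝓘(ℂ, C3) (e.symm z) :=
  (OpenPartialHomeomorph.MDifferentiable.mfderiv
    (mdifferentiable_of_mem_holCharts he).symm (x := z) hz).toLinearEquiv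

/-- The coordinate frame of the holomorphic tangent space. -/
def coordBasis {e : OpenPartialHomeomorph X C3} (he : e ∈ holCharts X) {z : C3}
    (hz : z ∈ e.target) : Module.Basis (Fin 3) ℂ (TangentSpace 𝓘(ℂ, C3) (e.symm z)) :=
  (Pi.basisFun ℂ (Fin 3)).map (coordEquiv he hz)

theorem coe_coordBasis {e : OpenPartialHomeomorph X C3} (he : e ∈ holCharts X) {z : C3}
    (hz : z ∈ e.target) : ⇑(coordBasis he hz) = coordVec e z := by
  funext j
  rw [coordBasis, Module.Basis.map_apply, Pi.basisFun_apply]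
  rfl

theorem mat_posDef {e : OpenPartialHomeomorph X C3} (he : e ∈ holCharts X) (g : HermMetric X)
    {z : C3} (hz : z ∈ e.target) : (g.mat e z).PosDef := by
  refine Matrix.PosDef.of_dotProduct_mulVec_pos ?_ fun x hx => ?_
  · ext j k
    exact g.conj_symm _ _ _
  · set v : TangentSpace 𝓘(ℂ, C3) (e.symm z) := ∑ j, x j • coordVec e z j with hv
    have hb : v = (coordBasis he hz).equivFun.symm x := by
      rw [Module.Basis.equivFun_symm_apply, coe_coordBasis]
    have hv0 : v ≠ 0 := by
      rw [hb]
      exact (LinearEquiv.map_ne_zero_iff _).mpr hx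
    have e1 : star x ⬝ᵥ Matrix.mulVec (g.mat e z) x = g.toFun (e.symm z) v v := by
      rw [hv]
      simp only [map_sum, LinearMap.sum_apply, dotProduct, Matrix.mulVec, HermMetric.mat,
        Matrix.of_apply, Pi.star_apply, Finset.mul_sum, LinearMap.map_smulₛₗ,
        LinearMap.smul_apply, smul_eq_mul, map_smul]
      rw [Finset.sum_comm]
      refine Finset.sum_congr rfl fun _ _ => Finset.sum_congr rfl fun _ _ => ?_
      simp only [RCLike.star_def]
      ring
    rw [e1, Complex.lt_def]
    refine ⟨g.pos _ _ hv0, ?_⟩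
    exact (Complex.conj_eq_iff_im.mp (g.conj_symm _ v v)).symm

theorem coeffs30_lll (Om : Form30 X) (e : OpenPartialHomeomorph X C3) :
    coeffs30 Om e ![Sum.inl 0, Sum.inl 1, Sum.inl 2]
      = fun z => Om (e.symm z) (coordVec e z) := by
  funext z
  have h : ∀ i : Fin 3, (((![Sum.inl 0, Sum.inl 1, Sum.inl 2] : Fin 3 → Idx) i).isLeft) := by
    decide
  rw [coeffs30, if_pos h]
  congr 1
  funext i
  fin_cases i <;> rfl

/-- The differential is complex linear, so its value in the direction i e_k is i times its value on
e_k, and the two terms of ∂_k̄ cancel. -/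
theorem wirt_inr_of_holomorphic {f : C3 → ℂ} {z : C3} (hf : DifferentiableAt ℂ f z) (k : Fin 3) :
    wirt (Sum.inr k) f z = 0 := by
  have e : (Pi.single k Complex.I : C3) = Complex.I • Pi.single k 1 := by
    rw [← Pi.single_smul, smul_eq_mul, mul_one]
  simp only [wirt]
  rw [hf.fderiv_restrictScalars ℝ, ContinuousLinearMap.coe_restrictScalars', e, map_smul,
    smul_eq_mul, ← mul_assoc, Complex.I_mul_I]
  ring

/-- The coordinate expression of a solution of the Anomaly flow. -/
theorem IsAnomalyFlow.localFlow {Om : Form30 X} (hOm : IsHolVolume Om) {α' τ : ℝ}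
    {Phi : ℝ → CForm X 4} (hPhi : ∀ t ∈ Set.Ico 0 τ, IsClosed22 (Phi t)) {g : ℝ → HermMetric X}
    (hg : IsAnomalyFlow Om α' Phi τ g) (h0 : IsConformallyBalanced Om (g 0))
    {e : OpenPartialHomeomorph X C3} (he : e ∈ holCharts X) :
    LocalFlow τ e.target (coeffs30 Om e) α' (fun t => coeffs (Phi t) e)
      (fun t => (g t).mat e) where
  isOpen := e.open_target
  smooth := hg.smooth e he
  posDef t _ z hz := mat_posDef he (g t) hz
  om_type a z h := if_neg h
  om_smooth := by
    rw [coeffs30_lll]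
    exact ((hOm.holomorphic e he).contDiffOn_of_completeSpace (n := ∞)).restrict_scalars ℝ
  om_ne_zero z hz := by
    rw [coeffs30_lll]
    show Om (e.symm z) (coordVec e z) ≠ 0
    rw [← coe_coordBasis he hz]
    exact (AlternatingMap.map_basis_ne_zero_iff _ _).mpr (hOm.ne_zero _)
  om_holomorphic k z hz := by
    rw [coeffs30_lll]
    exact wirt_inr_of_holomorphic (hOm.holomorphic e he z hz).differentiableAt k
  phi_smooth t ht := (hPhi t ht).smooth e he
  phi_type t ht := (hPhi t ht).type22 e he
  phi_closed t ht := (hPhi t ht).closed e he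
  flow := hg.flow e he
  balanced := h0 e he

end Manifold

end AnomalyFlow

end


theorem theorem5 {X : Type*} [TopologicalSpace X] [ChartedSpace C3 X]
    [IsManifold 𝓘(ℂ, C3) ω X]
    (Om : Form30 X) (hOm : IsHolVolume Om) (α' : ℝ) (τ : ℝ)
    (Phi : ℝ → CForm X 4) (hPhi : ∀ t ∈ Set.Ico 0 τ, IsClosed22 (Phi t))
    (g : ℝ → HermMetric X) (hg : IsAnomalyFlow Om α' Phi τ g)
    (h0 : IsConformallyBalanced Om (g 0))
    (e : OpenPartialHomeomorph X C3) (he : e ∈ holCharts X)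
    (t : ℝ) (ht : t ∈ Set.Ico 0 τ) (z : C3) (hz : z ∈ e.target) (p j q : Fin 3) :
    let G : MatFun := (g t).mat e
    let Φ : Coeffs 4 := coeffs (Phi t) e
    let c : ℂ := 1 / (2 * (normOm (coeffs30 Om e) G z : ℂ))
    HasDerivWithinAt (fun s => tor ((g s).mat e) p j q z)
      (c * (lapTor G p j q z - (α' : ℂ) * nablaRRPhi Φ G j p q z
            + (α' : ℂ) * nablaRRPhi Φ G q p j z)
        + c * ((∑ m, torUp G m j q z * Psi2 α' Φ G p m z)
            - torTr G j z * Psi2 α' Φ G p q z + torTr G q z * Psi2 α' Φ G p j z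
            + nablaTT G j p q z - nablaTT G q p j z)
        - c * ((∑ r, ∑ l, torUp G r q l z * curvUp G l r p j z)
            - ∑ r, ∑ l, torUp G r j l z * curvUp G l r p q z))
      (Set.Ico 0 τ) t := by
  exact (hg.localFlow hOm hPhi h0 he).hasDerivWithinAt_tor ht hz p j q
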